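/- All alphabets of outputs, and the input alphabets of the given boxes, are finite. Let $\mathscr F$ be the class of non-affine convex functions $\Phi:D\to\mathbb R$ on a convex set $D\subseteq\mathbb R$ that are continuous on $D$, $C^\infty$ on the interior of $D$, and such that $1/\Phi''$ is concave on the interior of $D$. For a $D$-valued function $f$ of a random variable put $H_\Phi(f)=\mathbb E[\Phi(f)]-\Phi(\mathbb E[f])$. The $\Phi$-ribbon of a pair $(A,B)$ of random variables is $$\mathfrak R_\Phi(A;B)=\{(\lambda_1,\lambda_2)\in[0,1]^2:\ \lambda_1H_\Phi(\mathbb E[f|A])+\lambda_2H_\Phi(\mathbb E[f|B])\le H_\Phi(f)\ \text{ for all } f=f(A,B) \text{ with values in } D\}.$$ A no-signaling box is a conditional distribution $p(ab|xy)$ such that $\sum_b p(ab|xy)$ does not depend on $y$ and $\sum_a p(ab|xy)$ does not depend on $x$. Its $\Phi$-ribbon is $$\mathfrak R_\Phi(A;B|X;Y)=\bigcap_{x,y}\mathfrak R_\Phi(A;B|X=x,Y=y)\subseteq[0,1]^2,$$ where $\mathfrak R_\Phi(A;B|X=x,Y=y)$ is the $\Phi$-ribbon of a pair $(A,B)$ with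 distribution $p(\cdot\,\cdot|xy)$. Let $p_i(a_ib_i|x_iy_i)$, $i\in[n]$, be no-signaling boxes. In a wiring of these boxes, Alice gets an input $x'$ and Bob an input $y'$, and each party uses every box exactly once, in an order of its own. In each action Alice chooses at random a box that she has not yet used and an input for it, with a distribution that depends only on $x'$ and on her transcript so far (the boxes used, in order, with their inputs and outputs); after her last action she draws an output $a'$ from a distribution that depends only on $x'$ and her complete transcript. Bob acts likewise, with $y'$, his own transcript and an output $b'$; the random choices of the two parties are made independently of each other. Thus, given $x',y'$, the probability that Alice uses the boxes in the order $\tilde\pi_1,\dots,\tilde\pi_n$ with inputs $x_1,\dots,x_n$ and outputs $a_1,\dots,a_n$, and Bob in the order $\tilde\omega_1,\dots,\tilde\omega_n$ with inputs $y_1,\dots,y_n$ and outputs $b_1,\dots,b_n$, is the product of the conditional probabilities of all choices made by Alice, of those of all choices made by Bob, and of $\prod_{i=1}^n p_i(a_ib_i|x_iy_i)$. The wiring generates the box $p(a'b'|x'y')$ if, for all $x',y'$, the outputs $(a',b')$ have the distribution $p(\cdot\,\cdot|x'y')$. **Theorem.** Let $\Phi\in\mathscr F$. If a no-signaling box $p(a'b'|x'y')$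 is generated from $n$ no-signaling boxes $p_i(a_ib_i|x_iy_i)$, $i\in[n]$, by a wiring, then $$\bigcap_{i=1}^n\mathfrak R_\Phi(A_i;B_i|X_i;Y_i)\subseteq\mathfrak R_\Phi(A';B'|X';Y')$$ (for $n=0$ the left-hand side is $[0,1]^2$). -/

import Mathlib

open scoped ContDiff

noncomputable section

namespace PhiRibbon

/-- The class of non-affine smooth convex functions `Φ` on a convex set `D ⊆ ℝ` with `1 / Φ''`
concave.  At end points of `D` that belong to `D` only continuity is asked for (as needed for
`t log t` on `[0, ∞)`); derivatives are taken in the interior.  No point with `Φ'' = 0` occurs: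
if the nonnegative concave function `1 / Φ''` (with `1 / 0 = 0`) vanished at one interior point,
it would vanish on the whole interior and `Φ` would be affine.  As `Φ` is not affine on `D`, the
set `D` has nonempty interior. -/
structure IsClassF (D : Set ℝ) (Φ : ℝ → ℝ) : Prop where
  convexOn : ConvexOn ℝ D Φ
  continuousOn : ContinuousOn Φ D
  smooth : ContDiffOn ℝ ∞ Φ (interior D)
  not_affine : ¬ ∃ c d : ℝ, ∀ t ∈ D, Φ t = c * t + d
  concaveOn : ConcaveOn ℝ (interior D) (fun t => 1 / deriv (deriv Φ) t)

section Ribbon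

variable {A B : Type*} [Fintype A] [Fintype B]

/-- The `Φ`-entropy `E[Φ(f)] - Φ(E[f])` of `f` under the distribution `p`. -/
def phiEntropy {W : Type*} [Fintype W] (Φ : ℝ → ℝ) (p f : W → ℝ) : ℝ :=
  ∑ w, p w * Φ (f w) - Φ (∑ w, p w * f w)

/-- The marginal distribution of the first variable. -/
def margA (p : A × B → ℝ) (a : A) : ℝ := ∑ b, p (a, b)

/-- The marginal distribution of the second variable. -/
def margB (p : A × B → ℝ) (b : B) : ℝ := ∑ a, p (a, b)

/-- `E[f | A = a]`; its value at an `a` of probability zero is irrelevant. -/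
def condA (p f : A × B → ℝ) (a : A) : ℝ := (∑ b, p (a, b) * f (a, b)) / margA p a

/-- `E[f | B = b]`; its value at a `b` of probability zero is irrelevant. -/
def condB (p f : A × B → ℝ) (b : B) : ℝ := (∑ a, p (a, b) * f (a, b)) / margB p b

/-- The `Φ`-ribbon of a joint distribution `p` of `(A, B)`: the pairs `(l₁, l₂) ∈ [0,1]²` with
`l₁ H_Φ(E[f|A]) + l₂ H_Φ(E[f|B]) ≤ H_Φ(f)` for all functions `f` of `(A, B)` with values in the
domain `D` of `Φ`. -/
def ribbon (D : Set ℝ) (Φ : ℝ → ℝ) (p : A × B → ℝ) : Set (unitInterval × unitInterval) :=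
  {l | ∀ f : A × B → ℝ, (∀ w, f w ∈ D) →
    (l.1 : ℝ) * phiEntropy Φ (margA p) (condA p f)
      + (l.2 : ℝ) * phiEntropy Φ (margB p) (condB p f) ≤ phiEntropy Φ p f}

end Ribbon

/-- A no-signaling box `p(ab|xy)`: `prob x y (a, b)` is the probability of the outputs `(a, b)`
on the inputs `(x, y)`. -/
structure NSBox (X Y A B : Type*) [Fintype A] [Fintype B] where
  prob : X → Y → A × B → ℝ
  prob_nonneg : ∀ x y w, 0 ≤ prob x y w
  prob_sum : ∀ x y, ∑ w, prob x y w = 1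
  noSignalingA : ∀ x y y' a, margA (prob x y) a = margA (prob x y') a
  noSignalingB : ∀ x x' y b, margB (prob x y) b = margB (prob x' y) b

/-- The `Φ`-ribbon of a box: the intersection over all inputs of the `Φ`-ribbons of the outputs. -/
def NSBox.ribbon {X Y A B : Type*} [Fintype A] [Fintype B] (D : Set ℝ) (Φ : ℝ → ℝ)
    (p : NSBox X Y A B) : Set (unitInterval × unitInterval) :=
  ⋂ x, ⋂ y, PhiRibbon.ribbon D Φ (p.prob x y)

section Wiring

variable {n : ℕ}

/-- A partial transcript of one party: the list, in the order of her actions, of the boxes used so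
far, each with the input given to it and the output received. -/
abbrev History (X A : Fin n → Type*) := List (Σ i, X i × A i)

/-- The (randomized) behaviour of one party in a wiring of `n` boxes, where her end of the `i`-th
box has inputs `X i` and outputs `A i`; `U` are her inputs and `O` her outputs of the simulated
box.  Given `u` and the transcript `h` so far, `choose u h ⟨i, x⟩` is the probability that her next
action is to use box `i` with input `x`; given `u` and the complete transcript `h`, `output u h o`
is the probability that she finally outputs `o`. Every box is used exactly once. -/
structure Strategy (X A : Fin n → Type*) (U O : Type*) [∀ i, Fintype (X i)] [Fintype O] where
  choose : U → History X A → (Σ i, X i) → ℝ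
  choose_nonneg : ∀ u h c, 0 ≤ choose u h c
  choose_used : ∀ u h c, c.1 ∈ h.map Sigma.fst → choose u h c = 0
  choose_sum : ∀ u h, (h.map Sigma.fst).Nodup → h.length < n → ∑ c, choose u h c = 1
  output : U → History X A → O → ℝ
  output_nonneg : ∀ u h o, 0 ≤ output u h o
  output_sum : ∀ u h, (h.map Sigma.fst).Nodup → h.length = n → ∑ o, output u h o = 1

/-- A complete run of one party: the order of use (`t.1 j` is the box used in action `j`), the
inputs `t.2.1 i` and the outputs `t.2.2 i` of all boxes `i`. -/
abbrev Run (X A : Fin n → Type*) := Equiv.Perm (Fin n) × (∀ i, X i) × (∀ i, A i)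

/-- The transcript after the first `k` actions of a run. -/
def Run.history {X A : Fin n → Type*} (t : Run X A) (k : ℕ) : History X A :=
  ((List.finRange n).take k).map (fun j => ⟨t.1 j, t.2.1 (t.1 j), t.2.2 (t.1 j)⟩)

/-- The product of the probabilities of all choices (of boxes and of inputs) that one party makes
along the run `t`, each conditioned on her transcript at that moment. -/
def Strategy.choiceWeight {X A : Fin n → Type*} {U O : Type*} [∀ i, Fintype (X i)] [Fintype O]
    (σ : Strategy X A U O) (u : U) (t : Run X A) : ℝ :=
  ∏ j : Fin n, σ.choose u (t.history j) ⟨t.1 j, t.2.1 (t.1 j)⟩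

variable {X Y A B : Fin n → Type*} [∀ i, Fintype (X i)] [∀ i, Fintype (Y i)]
  [∀ i, Fintype (A i)] [∀ i, Fintype (B i)]
  {X' Y' A' B' : Type*} [Fintype A'] [Fintype B']

/-- The joint probability that Alice's run is `t` and Bob's run is `s` when the inputs of the
simulated box are `u` and `v`: both parties make their choices from their own transcripts,
independently of each other, and box `i` answers according to `p i`. -/
def jointLaw (p : ∀ i, NSBox (X i) (Y i) (A i) (B i)) (σ : Strategy X A X' A')
    (τ : Strategy Y B Y' B') (u : X') (v : Y') (t : Run X A) (s : Run Y B) : ℝ :=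
  σ.choiceWeight u t * τ.choiceWeight v s *
    ∏ i, (p i).prob (t.2.1 i) (s.2.1 i) (t.2.2 i, s.2.2 i)

/-- The box `q` is generated from the boxes `p i` under a wiring: for some strategies of the two
parties, the pair of final outputs has the law `q`. -/
def IsWiring (p : ∀ i, NSBox (X i) (Y i) (A i) (B i)) (q : NSBox X' Y' A' B') : Prop :=
  ∃ (σ : Strategy X A X' A') (τ : Strategy Y B Y' B'), ∀ u v a b,
    q.prob u v (a, b) = ∑ t : Run X A, ∑ s : Run Y B,
      jointLaw p σ τ u v t s * σ.output u (t.history n) a * τ.output v (s.history n) b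

end Wiring

end PhiRibbon

end

set_option linter.unusedSectionVars false

namespace PhiRibbon

/-! ### Convexity of the `Φ`-entropy -/

variable {D : Set ℝ} {Φ : ℝ → ℝ}

/-! If `l₁ + l₂ ≤ 1`, the ribbon inequality holds for every distribution, by Jensen
(`mem_ribbon_of_add_le_one`). So let `l₁ + l₂ ≥ 1`.

Each party is unfolded into a decision tree of depth `N = 2n + 1`, in which choosing a box and an
input, receiving the answer, and producing the output are separate steps. No-signaling gives every
pair of states, Alice's after `j` steps and Bob's after `k`, a probability `W` that does not depend
on what the parties do later. For a function `f` of the outputs let `F(j,k)` be the expectation of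
`Φ(E[f | both states])`. The mixed second differences of `F` over the grid sum up to `F(N,N) -
F(N,0) - F(0,N) + F(0,0)`, so it suffices to bound them locally, at a pair of states.

If the two parties are not waiting for the same fresh box, their next steps are conditionally
independent and the difference is nonnegative. This is convexity of the `Φ`-entropy in `f`, which
comes from concavity of `1/Φ''` (`IsClassF.convexOn_phiEntropy`,
`IsClassF.persp_mixed_difference_nonneg`). If they wait for the same box, the ribbon of that box
bounds the difference below by `-(1-l₁) dA - (1-l₂) dB`, where `dA` and `dB` are the gains of `Φ`
from one step of Alice or of Bob alone (`ribbon_inequality_of_matched`).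

These losses must be paid for only once. Since a box is answered once, a pending state of Alice is
matched at most once along each path of Bob. Until then its gain `dA` can only have grown, on
average, by the nonnegative mixed differences already seen. A potential that carries the gain until
the match therefore telescopes to Alice's gain against Bob's initial state
(`Branching.ribbon_inequality_of_local`). Data processing from final states to outputs completes the
proof (`Branching.mem_ribbon_outLaw`). -/

lemma IsClassF.nonempty_interior (h : IsClassF D Φ) : (interior D).Nonempty := by
  by_contra hne
  have hss : D.Subsingleton := by
    intro x hx y hy
    by_contra hxy
    wlog hlt : x < y generalizing x y
    · exact this hy hx (Ne.symm hxy) (lt_of_le_of_ne (not_lt.mp hlt) (Ne.symm hxy))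
    apply hne
    have hsub : Set.Ioo x y ⊆ D := fun z hz =>
      h.convexOn.1.ordConnected.out hx hy ⟨hz.1.le, hz.2.le⟩
    exact (Set.nonempty_Ioo.mpr hlt).mono (interior_maximal hsub isOpen_Ioo)
  apply h.not_affine
  rcases hss.eq_empty_or_singleton with h0 | ⟨a, h1⟩
  · exact ⟨0, 0, by simp [h0]⟩
  · exact ⟨0, Φ a, by simp [h1]⟩

lemma IsClassF.hasDerivAt (h : IsClassF D Φ) {t : ℝ} (ht : t ∈ interior D) :
    HasDerivAt Φ (deriv Φ t) t :=
  ((h.smooth.differentiableOn (by simp)).differentiableAt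
    (isOpen_interior.mem_nhds ht)).hasDerivAt

lemma IsClassF.hasDerivAt_deriv (h : IsClassF D Φ) {t : ℝ} (ht : t ∈ interior D) :
    HasDerivAt (deriv Φ) (deriv (deriv Φ) t) t := by
  have h1 : ContDiffOn ℝ 1 (deriv Φ) (interior D) :=
    h.smooth.deriv_of_isOpen isOpen_interior (by
      have : ((2 : ℕ∞) : WithTop ℕ∞) ≤ ((⊤ : ℕ∞) : WithTop ℕ∞) := WithTop.coe_le_coe.mpr le_top
      simpa [one_add_one_eq_two] using this)
  exact ((h1.differentiableOn (by simp)).differentiableAt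
    (isOpen_interior.mem_nhds ht)).hasDerivAt

lemma IsClassF.deriv2_nonneg (h : IsClassF D Φ) {t : ℝ} (ht : t ∈ interior D) :
    0 ≤ deriv (deriv Φ) t := by
  have hc : ConvexOn ℝ (interior D) Φ :=
    h.convexOn.subset interior_subset h.convexOn.1.interior
  have hm : MonotoneOn (deriv Φ) (interior D) :=
    hc.monotoneOn_deriv fun x hx => (h.hasDerivAt hx).differentiableAt
  have h1 : 0 ≤ derivWithin (deriv Φ) (interior D) t := hm.derivWithin_nonneg
  rwa [derivWithin_of_isOpen isOpen_interior ht] at h1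

/-- Either `Φ''` is positive on the whole interior of `D`, or it vanishes there identically. -/
lemma IsClassF.deriv2_pos_or (h : IsClassF D Φ) :
    (∀ t ∈ interior D, 0 < deriv (deriv Φ) t) ∨ ∀ t ∈ interior D, deriv (deriv Φ) t = 0 := by
  by_contra! hcon
  obtain ⟨⟨x, hx, hx0⟩, y, hy, hy0⟩ := hcon
  have hxz : deriv (deriv Φ) x = 0 := le_antisymm hx0 (h.deriv2_nonneg hx)
  have hypos : 0 < deriv (deriv Φ) y := lt_of_le_of_ne (h.deriv2_nonneg hy) (Ne.symm hy0)
  -- a point `z` of the interior beyond `x`, seen from `y`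
  have hev : ∀ᶠ s in nhdsWithin (0 : ℝ) (Set.Ioi 0), x + s * (x - y) ∈ interior D := by
    have hcont : Filter.Tendsto (fun s : ℝ => x + s * (x - y)) (nhds 0) (nhds x) := by
      have : Continuous fun s : ℝ => x + s * (x - y) := by fun_prop
      simpa using this.tendsto 0
    exact (hcont.eventually (isOpen_interior.mem_nhds hx)).filter_mono nhdsWithin_le_nhds
  obtain ⟨s, hz, hs⟩ := (hev.and self_mem_nhdsWithin).exists
  have hs : 0 < s := hs
  have h1s : 0 < 1 + s := by linarith
  -- As `x` lies strictly between `y` and the new point, concavity bounds `1/Φ''(x)` below by a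
  -- positive multiple of `1/Φ''(y)`. With the convention `1/0 = 0` the left side is zero, a
  -- contradiction.
  have key := h.concaveOn.2 hy hz (show 0 ≤ s / (1 + s) by positivity)
    (show 0 ≤ 1 / (1 + s) by positivity) (by field_simp; ring)
  have hxx : (s / (1 + s)) • y + (1 / (1 + s)) • (x + s * (x - y)) = x := by
    simp only [smul_eq_mul]; field_simp; ring
  rw [hxx] at key
  simp only [hxz, smul_eq_mul, div_zero] at key
  have hzn : 0 ≤ 1 / deriv (deriv Φ) (x + s * (x - y)) :=
    div_nonneg zero_le_one (h.deriv2_nonneg hz)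
  have : 0 < s / (1 + s) * (1 / deriv (deriv Φ) y) := by positivity
  have : 0 ≤ 1 / (1 + s) * (1 / deriv (deriv Φ) (x + s * (x - y))) := by positivity
  linarith

variable {E : Type*} [Fintype E]

/-- The Hessian of the `Φ`-entropy is positive semidefinite. -/
lemma IsClassF.deriv2_mul_sq_le (h : IsClassF D Φ) {p f g : E → ℝ} (hp : ∀ e, 0 ≤ p e)
    (hp1 : ∑ e, p e = 1) (hf : ∀ e, f e ∈ interior D) :
    deriv (deriv Φ) (∑ e, p e * f e) * (∑ e, p e * g e) ^ 2
      ≤ ∑ e, p e * (deriv (deriv Φ) (f e) * g e ^ 2) := by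
  have hm : ∑ e, p e * f e ∈ interior D := by
    simpa using h.convexOn.1.interior.sum_mem (fun e _ => hp e) hp1 (fun e _ => hf e)
  rcases h.deriv2_pos_or with hpos | hzero
  · have hj : ∑ e, p e * (1 / deriv (deriv Φ) (f e)) ≤ 1 / deriv (deriv Φ) (∑ e, p e * f e) := by
      simpa using h.concaveOn.le_map_sum (fun e _ => hp e) hp1 (fun e _ => hf e)
    -- Cauchy–Schwarz after splitting `g` as `Φ''(f)^(-1/2)` times `Φ''(f)^(1/2) g`; the first
    -- factor is then bounded by Jensen for the concave `1/Φ''`.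
    have hcs : (∑ e, p e * g e) ^ 2 ≤ (∑ e, p e * (1 / deriv (deriv Φ) (f e))) *
        ∑ e, p e * (deriv (deriv Φ) (f e) * g e ^ 2) := by
      apply Finset.sum_sq_le_sum_mul_sum_of_sq_le_mul
      · intro e _
        have := hpos _ (hf e)
        have := hp e
        positivity
      · intro e _
        have := hpos _ (hf e)
        have := hp e
        positivity
      · intro e _
        have := (hpos _ (hf e)).ne'
        apply le_of_eq
        field_simp
    have hR : 0 ≤ ∑ e, p e * (deriv (deriv Φ) (f e) * g e ^ 2) :=
      Finset.sum_nonneg fun e _ => mul_nonneg (hp e)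
        (mul_nonneg (h.deriv2_nonneg (hf e)) (sq_nonneg _))
    have hmp := hpos _ hm
    calc _ ≤ deriv (deriv Φ) (∑ e, p e * f e) * ((1 / deriv (deriv Φ) (∑ e, p e * f e)) *
          ∑ e, p e * (deriv (deriv Φ) (f e) * g e ^ 2)) := by
            gcongr
            exact hcs.trans (mul_le_mul_of_nonneg_right hj hR)
      _ = _ := by field_simp
  · rw [hzero _ hm, zero_mul]
    exact Finset.sum_nonneg fun e _ => mul_nonneg (hp e)
        (mul_nonneg (h.deriv2_nonneg (hf e)) (sq_nonneg _))

/-- Along a segment the second derivative of the `Φ`-entropy is the difference of the two sides of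
`IsClassF.deriv2_mul_sq_le`. -/
lemma IsClassF.convexOn_phiEntropy_interior (h : IsClassF D Φ) {p : E → ℝ} (hp : ∀ e, 0 ≤ p e)
    (hp1 : ∑ e, p e = 1) :
    ConvexOn ℝ {f : E → ℝ | ∀ e, f e ∈ interior D} (phiEntropy Φ p) := by
  have hconv : Convex ℝ (interior D) := h.convexOn.1.interior
  refine ⟨fun x hx y hy a b ha hb hab e => hconv (hx e) (hy e) ha hb hab, ?_⟩
  intro x hx y hy a b ha hb hab
  let γ : ℝ → E → ℝ := fun s e => x e + s * (y e - x e)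
  have hγ : ∀ s ∈ Set.Icc (0 : ℝ) 1, ∀ e, γ s e ∈ interior D := by
    intro s hs e
    have := hconv (hx e) (hy e) (a := 1 - s) (b := s) (by linarith [hs.2]) hs.1 (by ring)
    simp only [smul_eq_mul] at this
    have h2 : γ s e = (1 - s) * x e + s * y e := by simp only [γ]; ring
    rwa [h2]
  have hγm : ∀ s ∈ Set.Icc (0 : ℝ) 1, ∑ e, p e * γ s e ∈ interior D := fun s hs => by
    simpa using hconv.sum_mem (fun e _ => hp e) hp1 (fun e _ => hγ s hs e)
  have hγd : ∀ s e, HasDerivAt (fun s => γ s e) (y e - x e) s := fun s e => by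
    have := ((hasDerivAt_id s).mul_const (y e - x e)).const_add (x e)
    rwa [one_mul] at this
  have hγmd : ∀ s, HasDerivAt (fun s => ∑ e, p e * γ s e) (∑ e, p e * (y e - x e)) s :=
    fun s => HasDerivAt.fun_sum fun e _ => (hγd s e).const_mul (p e)
  let ψ' : ℝ → ℝ := fun s => ∑ e, p e * (deriv Φ (γ s e) * (y e - x e))
    - deriv Φ (∑ e, p e * γ s e) * ∑ e, p e * (y e - x e)
  let ψ'' : ℝ → ℝ := fun s => ∑ e, p e * (deriv (deriv Φ) (γ s e) * (y e - x e) * (y e - x e))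
    - deriv (deriv Φ) (∑ e, p e * γ s e) * (∑ e, p e * (y e - x e)) * ∑ e, p e * (y e - x e)
  have hψ' : ∀ s ∈ Set.Icc (0 : ℝ) 1,
      HasDerivAt (fun s => phiEntropy Φ p (γ s)) (ψ' s) s := by
    intro s hs
    refine HasDerivAt.sub (HasDerivAt.fun_sum fun e _ => ?_) ?_
    · exact ((h.hasDerivAt (hγ s hs e)).comp s (hγd s e)).const_mul (p e)
    · exact (h.hasDerivAt (hγm s hs)).comp s (hγmd s)
  have hψ'' : ∀ s ∈ Set.Icc (0 : ℝ) 1, HasDerivAt ψ' (ψ'' s) s := by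
    intro s hs
    refine HasDerivAt.sub (HasDerivAt.fun_sum fun e _ => ?_) ?_
    · exact (((h.hasDerivAt_deriv (hγ s hs e)).comp s (hγd s e)).mul_const _).const_mul (p e)
    · exact ((h.hasDerivAt_deriv (hγm s hs)).comp s (hγmd s)).mul_const _
  have hcvx : ConvexOn ℝ (Set.Icc (0 : ℝ) 1) (fun s => phiEntropy Φ p (γ s)) := by
    refine convexOn_of_hasDerivWithinAt2_nonneg (f' := ψ') (f'' := ψ'') (convex_Icc 0 1)
      (fun s hs => (hψ' s hs).continuousAt.continuousWithinAt)
      (fun s hs => (hψ' s (interior_subset hs)).hasDerivWithinAt)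
      (fun s hs => (hψ'' s (interior_subset hs)).hasDerivWithinAt) ?_
    intro s hs
    have := h.deriv2_mul_sq_le (g := fun e => y e - x e) hp hp1 (hγ s (interior_subset hs))
    simp only [ψ'']
    rw [sub_nonneg]
    calc _ = _ := by ring
      _ ≤ _ := this
      _ = _ := by refine Finset.sum_congr rfl fun e _ => ?_; ring
  have := hcvx.2 (x := 0) (by simp) (y := 1) (by simp) ha hb hab
  have e0 : γ 0 = x := by funext e; simp [γ]
  have e1 : γ 1 = y := by funext e; simp [γ]
  have eb : γ b = a • x + b • y := by
    funext e
    simp only [γ, Pi.add_apply, Pi.smul_apply, smul_eq_mul]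
    rw [← eq_sub_iff_add_eq] at hab
    rw [hab]; ring
  simpa [e0, e1, eb] using this

/-- The `Φ`-entropy is convex on the functions with values in `D`. -/
lemma IsClassF.convexOn_phiEntropy (h : IsClassF D Φ) {p : E → ℝ} (hp : ∀ e, 0 ≤ p e)
    (hp1 : ∑ e, p e = 1) : ConvexOn ℝ {f : E → ℝ | ∀ e, f e ∈ D} (phiEntropy Φ p) := by
  have hconv : Convex ℝ D := h.convexOn.1
  have hD : Convex ℝ {f : E → ℝ | ∀ e, f e ∈ D} :=
    fun x hx y hy a b ha hb hab e => hconv (hx e) (hy e) ha hb hab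
  refine ⟨hD, ?_⟩
  obtain ⟨c, hc⟩ := h.nonempty_interior
  -- move the functions into the interior along the segments to `c`
  let push : ℝ → (E → ℝ) → E → ℝ := fun s x e => x e + s * (c - x e)
  have hpushI : ∀ x : E → ℝ, (∀ e, x e ∈ D) → ∀ s ∈ Set.Ioc (0 : ℝ) 1, ∀ e,
      push s x e ∈ interior D := by
    intro x hx s hs e
    have := hconv.add_smul_sub_mem_interior (hx e) hc hs
    simpa [push] using this
  have hpush : ∀ x : E → ℝ, (∀ e, x e ∈ D) → ∀ s ∈ Set.Icc (0 : ℝ) 1, ∀ e, push s x e ∈ D := by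
    intro x hx s hs e
    have := hconv.add_smul_sub_mem (hx e) (interior_subset hc) hs
    simpa [push] using this
  -- Only continuity of `Φ` on `D` is available at end points, so the interior inequality is carried
  -- to `D` by letting `s` tend to `0` from the right.
  have hcont : ∀ x : E → ℝ, (∀ e, x e ∈ D) →
      Filter.Tendsto (fun s => phiEntropy Φ p (push s x)) (nhdsWithin 0 (Set.Ioc 0 1))
        (nhds (phiEntropy Φ p x)) := by
    intro x hx
    have hco : ContinuousOn (fun s => phiEntropy Φ p (push s x)) (Set.Icc 0 1) := by
      refine ContinuousOn.sub (continuousOn_finsetSum _ fun e _ => continuousOn_const.mul ?_) ?_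
      · exact h.continuousOn.comp (by simp only [push]; fun_prop)
          fun s hs => hpush x hx s hs e
      · refine h.continuousOn.comp (by simp only [push]; fun_prop) fun s hs => ?_
        simpa using hconv.sum_mem (fun e _ => hp e) hp1 (fun e _ => hpush x hx s hs e)
    have h0 : push 0 x = x := by funext e; simp [push]
    have := (hco 0 (by simp)).mono Set.Ioc_subset_Icc_self
    simpa [ContinuousWithinAt, h0] using this
  intro x hx y hy a b ha hb hab
  have : (nhdsWithin (0 : ℝ) (Set.Ioc 0 1)).NeBot := by
    rw [nhdsWithin_Ioc_eq_nhdsGT one_pos]; infer_instance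
  refine le_of_tendsto_of_tendsto (hcont _ (hD hx hy ha hb hab))
    (((hcont x hx).const_mul a).add ((hcont y hy).const_mul b)) ?_
  filter_upwards [self_mem_nhdsWithin] with s hs
  have := (h.convexOn_phiEntropy_interior hp hp1).2 (hpushI x hx s hs) (hpushI y hy s hs) ha hb hab
  have hlin : push s (a • x + b • y) = a • push s x + b • push s y := by
    funext e
    simp only [push, Pi.add_apply, Pi.smul_apply, smul_eq_mul]
    linear_combination (-(s * c)) * hab
  rw [hlin]
  simpa using this

end PhiRibbon

namespace PhiRibbon

/-! ### Telescoping on pairs of trees -/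

/-- A finitely branching process on the states `G`: `step g e` are the successors of `g`. -/
structure Branching (G : Type*) where
  Next : G → Type*
  [fintype : ∀ g, Fintype (Next g)]
  step : ∀ g, Next g → G

attribute [instance] Branching.fintype

namespace Branching

variable {G H : Type*} (T : Branching G) (S : Branching H)

/-- The operator that sums a function over the successors of a state. -/
def sum : Module.End ℝ (G → ℝ) where
  toFun φ g := ∑ e, φ (T.step g e)
  map_add' φ ψ := by funext g; simp [Finset.sum_add_distrib]
  map_smul' c φ := by funext g; simp [Finset.mul_sum]

lemma sum_apply (φ : G → ℝ) (g : G) : T.sum φ g = ∑ e, φ (T.step g e) := rfl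

lemma sum_pow_succ_apply (j : ℕ) (φ : G → ℝ) (g : G) :
    (T.sum ^ (j + 1)) φ g = ∑ e, (T.sum ^ j) φ (T.step g e) := by
  rw [pow_succ']; rfl

lemma sum_pow_mono {φ ψ : G → ℝ} (h : φ ≤ ψ) (j : ℕ) : (T.sum ^ j) φ ≤ (T.sum ^ j) ψ := by
  induction j with
  | zero => simpa using h
  | succ j ih =>
    intro g
    rw [sum_pow_succ_apply, sum_pow_succ_apply]
    exact Finset.sum_le_sum fun e _ => ih _

/-- The sum of a function of two states over the pairs of states that are reached after `j` steps
from `g₀` and `k` steps from `h₀`. -/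
def pairSum (g₀ : G) (h₀ : H) (j k : ℕ) : (G → H → ℝ) →ₗ[ℝ] ℝ where
  toFun ψ := (T.sum ^ j) (fun g => (S.sum ^ k) (ψ g) h₀) g₀
  map_add' φ ψ := by
    have : (fun g => (S.sum ^ k) ((φ + ψ) g) h₀)
        = (fun g => (S.sum ^ k) (φ g) h₀) + fun g => (S.sum ^ k) (ψ g) h₀ := by
      funext g; simp
    rw [this, map_add, Pi.add_apply]
  map_smul' c φ := by
    have : (fun g => (S.sum ^ k) ((c • φ) g) h₀) = c • fun g => (S.sum ^ k) (φ g) h₀ := by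
      funext g; simp
    rw [this, map_smul, Pi.smul_apply, RingHom.id_apply]

variable (g₀ : G) (h₀ : H)

lemma pairSum_apply (j k : ℕ) (ψ : G → H → ℝ) :
    T.pairSum S g₀ h₀ j k ψ = (T.sum ^ j) (fun g => (S.sum ^ k) (ψ g) h₀) g₀ := rfl

lemma pairSum_zero_zero (ψ : G → H → ℝ) : T.pairSum S g₀ h₀ 0 0 ψ = ψ g₀ h₀ := by
  simp [pairSum_apply]

lemma pairSum_mono {φ ψ : G → H → ℝ} (h : ∀ g h, φ g h ≤ ψ g h) (j k : ℕ) :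
    T.pairSum S g₀ h₀ j k φ ≤ T.pairSum S g₀ h₀ j k ψ :=
  T.sum_pow_mono (fun g => S.sum_pow_mono (fun h' => h g h') k h₀) j g₀

lemma pairSum_nonneg {φ : G → H → ℝ} (h : ∀ g h, 0 ≤ φ g h) (j k : ℕ) :
    0 ≤ T.pairSum S g₀ h₀ j k φ := by
  have := T.pairSum_mono S g₀ h₀ (φ := 0) h j k
  rwa [map_zero] at this

lemma pairSum_succ_left (j k : ℕ) (ψ : G → H → ℝ) :
    T.pairSum S g₀ h₀ (j + 1) k ψ =
      T.pairSum S g₀ h₀ j k (fun g h => ∑ e, ψ (T.step g e) h) := by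
  rw [pairSum_apply, pairSum_apply, pow_succ, Module.End.mul_apply]
  refine congrFun (congrArg _ (funext fun g => ?_)) g₀
  have : (fun h => ∑ e, ψ (T.step g e) h) = ∑ e, ψ (T.step g e) := by
    funext h; simp
  rw [this, map_sum, Finset.sum_apply, sum_apply]

lemma pairSum_succ_right (j k : ℕ) (ψ : G → H → ℝ) :
    T.pairSum S g₀ h₀ j (k + 1) ψ =
      T.pairSum S g₀ h₀ j k (fun g h => ∑ e, ψ g (S.step h e)) := by
  rw [pairSum_apply, pairSum_apply]
  congr 2

/-- If the second differences of `Ψ` are nonnegative at all pairs of states that are not matched,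
matched pairs satisfy a ribbon inequality, and every state has at most one match along each path
of the other tree, then `Ψ` satisfies the ribbon inequality globally. -/
theorem ribbon_inequality_of_local (N : ℕ) (Ψ : ℕ → ℕ → G → H → ℝ) (M aliveA aliveB : G → H → Prop)
    {l₁ l₂ : ℝ} (hl₁ : l₁ ≤ 1) (hl₂ : l₂ ≤ 1) (hl : 1 ≤ l₁ + l₂)
    (hδA : ∀ j k g h, j < N → k ≤ N → Ψ j k g h ≤ ∑ e, Ψ (j + 1) k (T.step g e) h)
    (hδB : ∀ j k g h, j ≤ N → k < N → Ψ j k g h ≤ ∑ e, Ψ j (k + 1) g (S.step h e))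
    (hU : ∀ j k g h, j < N → k < N → ¬ M g h →
      ∑ e, Ψ (j + 1) k (T.step g e) h + ∑ e, Ψ j (k + 1) g (S.step h e)
        ≤ ∑ e, ∑ e', Ψ (j + 1) (k + 1) (T.step g e) (S.step h e') + Ψ j k g h)
    (hM : ∀ j k g h, j < N → k < N → M g h →
      l₁ * (∑ e, Ψ (j + 1) k (T.step g e) h - Ψ j k g h)
        + l₂ * (∑ e, Ψ j (k + 1) g (S.step h e) - Ψ j k g h)
        ≤ ∑ e, ∑ e', Ψ (j + 1) (k + 1) (T.step g e) (S.step h e') - Ψ j k g h)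
    (hMA : ∀ g h, M g h → aliveA g h) (hMB : ∀ g h, M g h → aliveB g h)
    (hA : ∀ g h e, aliveA g (S.step h e) ↔ aliveA g h ∧ ¬ M g h)
    (hB : ∀ g h e, aliveB (T.step g e) h ↔ aliveB g h ∧ ¬ M g h) :
    l₁ * (T.pairSum S g₀ h₀ N 0 (Ψ N 0) - Ψ 0 0 g₀ h₀)
      + l₂ * (T.pairSum S g₀ h₀ 0 N (Ψ 0 N) - Ψ 0 0 g₀ h₀)
      ≤ T.pairSum S g₀ h₀ N N (Ψ N N) - Ψ 0 0 g₀ h₀ := by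
  classical
  let P := T.pairSum S g₀ h₀
  let dA : ℕ → ℕ → G → H → ℝ := fun j k g h => ∑ e, Ψ (j + 1) k (T.step g e) h - Ψ j k g h
  let dB : ℕ → ℕ → G → H → ℝ := fun j k g h => ∑ e, Ψ j (k + 1) g (S.step h e) - Ψ j k g h
  let F : ℕ → ℕ → ℝ := fun j k => P j k (Ψ j k)
  -- The potential: Alice's one-step gain, counted only where her match still lies ahead or is
  -- happening now.
  let IA : ℕ → ℕ → ℝ := fun j k => P j k (fun g h => if aliveA g h then dA j k g h else 0)
  let IB : ℕ → ℕ → ℝ := fun j k => P j k (fun g h => if aliveB g h then dB j k g h else 0)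
  have hdA : ∀ j k, j < N → k ≤ N → ∀ g h, 0 ≤ dA j k g h := fun j k hj hk g h =>
    sub_nonneg.mpr (hδA j k g h hj hk)
  have hdB : ∀ j k, j ≤ N → k < N → ∀ g h, 0 ≤ dB j k g h := fun j k hj hk g h =>
    sub_nonneg.mpr (hδB j k g h hj hk)
  have hPdA : ∀ j k, P j k (dA j k) = F (j + 1) k - F j k := by
    intro j k
    have : dA j k = (fun g h => ∑ e, Ψ (j + 1) k (T.step g e) h) - Ψ j k := rfl
    rw [this, map_sub, ← T.pairSum_succ_left S]
  have hPdB : ∀ j k, P j k (dB j k) = F j (k + 1) - F j k := by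
    intro j k
    have : dB j k = (fun g h => ∑ e, Ψ j (k + 1) g (S.step h e)) - Ψ j k := rfl
    rw [this, map_sub, ← T.pairSum_succ_right S]
  -- The increments of the two potentials pay for the mixed difference of one grid cell. At a match
  -- the carried gains are released, which is `hM` rearranged; elsewhere a live gain grows by
  -- exactly the mixed difference.
  have cell : ∀ j k, j < N → k < N →
      (1 - l₁) * (IA j (k + 1) - IA j k) + (1 - l₂) * (IB (j + 1) k - IB j k)
        ≤ F (j + 1) (k + 1) - F (j + 1) k - (F j (k + 1) - F j k) := by
    intro j k hj hk
    have e1 : F (j + 1) (k + 1)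
        = P j k (fun g h => ∑ e, ∑ e', Ψ (j + 1) (k + 1) (T.step g e) (S.step h e')) := by
      simp only [F, P, T.pairSum_succ_right S, T.pairSum_succ_left S]
    have e2 : F (j + 1) k = P j k (fun g h => ∑ e, Ψ (j + 1) k (T.step g e) h) := by
      simp only [F, P, T.pairSum_succ_left S]
    have e3 : IA j (k + 1) = P j k (fun g h => ∑ e',
        if aliveA g (S.step h e') then dA j (k + 1) g (S.step h e') else 0) := by
      simp only [IA, P, T.pairSum_succ_right S]
    have e4 : IB (j + 1) k = P j k (fun g h => ∑ e,
        if aliveB (T.step g e) h then dB (j + 1) k (T.step g e) h else 0) := by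
      simp only [IB, P, T.pairSum_succ_left S]
    rw [e1, e2, e3, e4, ← hPdB, ← map_sub, ← map_sub, ← map_sub, ← map_sub, ← smul_eq_mul,
      ← smul_eq_mul, ← map_smul, ← map_smul, ← map_add]
    refine T.pairSum_mono S g₀ h₀ (fun g h => ?_) j k
    simp only [Pi.sub_apply, Pi.add_apply, Pi.smul_apply, smul_eq_mul, hA, hB]
    by_cases hm : M g h
    · have := hM j k g h hj hk hm
      simp only [hm, hMA g h hm, hMB g h hm, not_true_eq_false, and_false, if_false, if_true,
        Finset.sum_const_zero, dA, dB]
      linarith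
    · have hu := hU j k g h hj hk hm
      have sA : ∑ e', dA j (k + 1) g (S.step h e') - dA j k g h =
          ∑ e, ∑ e', Ψ (j + 1) (k + 1) (T.step g e) (S.step h e')
            - ∑ e, Ψ (j + 1) k (T.step g e) h - dB j k g h := by
        simp only [dA, dB, Finset.sum_sub_distrib]
        rw [Finset.sum_comm]
        ring
      have sB : ∑ e, dB (j + 1) k (T.step g e) h - dB j k g h =
          ∑ e, ∑ e', Ψ (j + 1) (k + 1) (T.step g e) (S.step h e')
            - ∑ e, Ψ (j + 1) k (T.step g e) h - dB j k g h := by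
        simp only [dB, Finset.sum_sub_distrib]
      have hnn : 0 ≤ ∑ e, ∑ e', Ψ (j + 1) (k + 1) (T.step g e) (S.step h e')
            - ∑ e, Ψ (j + 1) k (T.step g e) h - dB j k g h := by
        simp only [dB]; linarith
      simp only [hm, not_false_eq_true, and_true]
      set Δ := ∑ e, ∑ e', Ψ (j + 1) (k + 1) (T.step g e) (S.step h e')
            - ∑ e, Ψ (j + 1) k (T.step g e) h - dB j k g h with hΔ
      -- The left side is `Δ` times `2 - l₁ - l₂`, `1 - l₁`, `1 - l₂` or `0`. Each factor is at most
      -- `1`, since `l₁ + l₂ ≥ 1` and `l₁, l₂ ≤ 1`, while `Δ ≥ 0`.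
      by_cases ha : aliveA g h <;> by_cases hb : aliveB g h <;>
        simp only [ha, hb, if_true, if_false, Finset.sum_const_zero, sA, sB, sub_zero, mul_zero] <;>
        nlinarith
  have hsum : ∑ j ∈ Finset.range N, ∑ k ∈ Finset.range N,
      ((1 - l₁) * (IA j (k + 1) - IA j k) + (1 - l₂) * (IB (j + 1) k - IB j k))
      ≤ ∑ j ∈ Finset.range N, ∑ k ∈ Finset.range N,
        (F (j + 1) (k + 1) - F (j + 1) k - (F j (k + 1) - F j k)) :=
    Finset.sum_le_sum fun j hj => Finset.sum_le_sum fun k hk =>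
      cell j k (Finset.mem_range.mp hj) (Finset.mem_range.mp hk)
  have r : ∑ j ∈ Finset.range N, ∑ k ∈ Finset.range N,
        (F (j + 1) (k + 1) - F (j + 1) k - (F j (k + 1) - F j k))
        = F N N - F N 0 - (F 0 N - F 0 0) := by
    have : ∀ j, ∑ k ∈ Finset.range N, (F (j + 1) (k + 1) - F (j + 1) k - (F j (k + 1) - F j k))
        = (F (j + 1) N - F (j + 1) 0) - (F j N - F j 0) := by
      intro j
      rw [Finset.sum_sub_distrib, Finset.sum_range_sub (fun k => F (j + 1) k),
        Finset.sum_range_sub (fun k => F j k)]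
    simp only [this]
    rw [Finset.sum_range_sub (fun j => F j N - F j 0)]
  -- For fixed `j` the potential telescopes in `k`; it is nonnegative at the end and at most Alice's
  -- full gain at the start.
  have lA : -(F N 0 - F 0 0) ≤
      ∑ j ∈ Finset.range N, ∑ k ∈ Finset.range N, (IA j (k + 1) - IA j k) := by
    rw [← Finset.sum_range_sub (fun j => F j 0), ← Finset.sum_neg_distrib]
    refine Finset.sum_le_sum fun j hj => ?_
    have hj := Finset.mem_range.mp hj
    rw [Finset.sum_range_sub (fun k => IA j k), ← hPdA]
    have h1 : 0 ≤ IA j N := T.pairSum_nonneg S g₀ h₀ (fun g h => by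
      split_ifs
      · exact hdA j N hj le_rfl g h
      · exact le_rfl) _ _
    have h2 : IA j 0 ≤ P j 0 (dA j 0) := T.pairSum_mono S g₀ h₀ (fun g h => by
      split_ifs
      · exact le_rfl
      · exact hdA j 0 hj (Nat.zero_le _) g h) _ _
    linarith
  have lB : -(F 0 N - F 0 0) ≤
      ∑ j ∈ Finset.range N, ∑ k ∈ Finset.range N, (IB (j + 1) k - IB j k) := by
    rw [Finset.sum_comm, ← Finset.sum_range_sub (fun k => F 0 k), ← Finset.sum_neg_distrib]
    refine Finset.sum_le_sum fun k hk => ?_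
    have hk := Finset.mem_range.mp hk
    rw [Finset.sum_range_sub (fun j => IB j k), ← hPdB]
    have h1 : 0 ≤ IB N k := T.pairSum_nonneg S g₀ h₀ (fun g h => by
      split_ifs
      · exact hdB N k le_rfl hk g h
      · exact le_rfl) _ _
    have h2 : IB 0 k ≤ P 0 k (dB 0 k) := T.pairSum_mono S g₀ h₀ (fun g h => by
      split_ifs
      · exact le_rfl
      · exact hdB 0 k (Nat.zero_le _) hk g h) _ _
    linarith
  rw [r] at hsum
  simp only [Finset.sum_add_distrib, ← Finset.mul_sum] at hsum
  have mA := mul_le_mul_of_nonneg_left lA (sub_nonneg.mpr hl₁)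
  have mB := mul_le_mul_of_nonneg_left lB (sub_nonneg.mpr hl₂)
  have h00 : F 0 0 = Ψ 0 0 g₀ h₀ := T.pairSum_zero_zero S g₀ h₀ _
  change l₁ * (F N 0 - _) + l₂ * (F 0 N - _) ≤ F N N - _
  rw [← h00]
  linarith

end Branching

/-! ### The local inequalities -/

/-- The perspective `w Φ(v / w)` of `Φ`. -/
noncomputable def persp (Φ : ℝ → ℝ) (w v : ℝ) : ℝ := w * Φ (v / w)

variable {D : Set ℝ} {Φ : ℝ → ℝ}

/-- Valid also for `w = 0`, where both sides vanish; thus null events need no separate treatment on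
the cone. -/
lemma persp_mul (w d : ℝ) : persp Φ w (w * d) = w * Φ d := by
  unfold persp
  rcases eq_or_ne w 0 with rfl | hw
  · simp
  · rw [mul_div_cancel_left₀ _ hw]

@[simp] lemma persp_zero_left (v : ℝ) : persp Φ 0 v = 0 := by simp [persp]

lemma persp_mul_mul {c : ℝ} (hc : c ≠ 0) (w v : ℝ) :
    persp Φ (c * w) (c * v) = c * persp Φ w v := by
  rw [persp, persp, mul_div_mul_left _ _ hc, mul_assoc]

/-- `v` is the integral of a `D`-valued function against a measure of mass `w`. -/
def InCone (D : Set ℝ) (w v : ℝ) : Prop := 0 ≤ w ∧ ∃ d ∈ D, v = w * d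

/-- For positive total mass the required point of `D` is the weighted mean; for zero mass all
summands vanish and any point of `D` serves. -/
lemma InCone.sum {ι : Type*} (hD : Convex ℝ D) (hne : D.Nonempty) (s : Finset ι) {w v : ι → ℝ}
    (h : ∀ i ∈ s, InCone D (w i) (v i)) : InCone D (∑ i ∈ s, w i) (∑ i ∈ s, v i) := by
  have h0 : ∀ i ∈ s, 0 ≤ w i := fun i hi => (h i hi).1
  refine ⟨Finset.sum_nonneg h0, ?_⟩
  rcases (Finset.sum_nonneg h0).eq_or_lt with hw | hw
  · obtain ⟨d, hd⟩ := hne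
    refine ⟨d, hd, ?_⟩
    rw [← hw, zero_mul]
    refine Finset.sum_eq_zero fun i hi => ?_
    obtain ⟨d, -, hv⟩ := (h i hi).2
    rw [hv, (Finset.sum_eq_zero_iff_of_nonneg h0).mp hw.symm i hi, zero_mul]
  · have : ∀ i, ∃ d, i ∈ s → d ∈ D ∧ v i = w i * d := fun i => by
      by_cases hi : i ∈ s
      · obtain ⟨d, hd⟩ := (h i hi).2
        exact ⟨d, fun _ => hd⟩
      · exact ⟨0, fun h => absurd h hi⟩
    choose d hd using this
    refine ⟨s.centerMass w d, hD.centerMass_mem h0 hw fun i hi => (hd i hi).1, ?_⟩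
    rw [Finset.centerMass, smul_eq_mul, mul_inv_cancel_left₀ hw.ne']
    exact Finset.sum_congr rfl fun i hi => (hd i hi).2

/-- Jensen's inequality for the perspective of a convex function. -/
lemma persp_sum_le {ι : Type*} (hΦ : ConvexOn ℝ D Φ) (s : Finset ι) {w v : ι → ℝ}
    (h : ∀ i ∈ s, InCone D (w i) (v i)) :
    persp Φ (∑ i ∈ s, w i) (∑ i ∈ s, v i) ≤ ∑ i ∈ s, persp Φ (w i) (v i) := by
  have h0 : ∀ i ∈ s, 0 ≤ w i := fun i hi => (h i hi).1
  rcases (Finset.sum_nonneg h0).eq_or_lt with hw | hw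
  · rw [← hw, persp_zero_left]
    refine Finset.sum_nonneg fun i hi => ?_
    rw [(Finset.sum_eq_zero_iff_of_nonneg h0).mp hw.symm i hi, persp_zero_left]
  · have : ∀ i, ∃ d, i ∈ s → d ∈ D ∧ v i = w i * d := fun i => by
      by_cases hi : i ∈ s
      · obtain ⟨d, hd⟩ := (h i hi).2
        exact ⟨d, fun _ => hd⟩
      · exact ⟨0, fun h => absurd h hi⟩
    choose d hd using this
    have hj := hΦ.map_centerMass_le h0 hw fun i hi => (hd i hi).1
    simp only [Finset.centerMass, smul_eq_mul, Function.comp] at hj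
    have hv : ∑ i ∈ s, v i = ∑ i ∈ s, w i * d i := Finset.sum_congr rfl fun i hi => (hd i hi).2
    have hp : ∑ i ∈ s, persp Φ (w i) (v i) = ∑ i ∈ s, w i * Φ (d i) :=
      Finset.sum_congr rfl fun i hi => by rw [(hd i hi).2, persp_mul]
    rw [hv, hp, persp, div_eq_inv_mul]
    calc _ ≤ (∑ i ∈ s, w i) * ((∑ i ∈ s, w i)⁻¹ * ∑ i ∈ s, w i * Φ (d i)) :=
          mul_le_mul_of_nonneg_left hj hw.le
      _ = _ := mul_inv_cancel_left₀ (ne_of_gt hw) _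

/-- Nonnegativity of the mixed second difference of the `Φ`-entropy for a product law. -/
lemma IsClassF.persp_mixed_difference_nonneg (h : IsClassF D Φ) {E E' : Type*} [Fintype E]
    [Fintype E'] {w v : E → E' → ℝ} (hc : ∀ e e', InCone D (w e e') (v e e'))
    (hprod : ∀ e e', w e e' * ∑ e, ∑ e', w e e' = (∑ e', w e e') * ∑ e, w e e') :
    ∑ e, persp Φ (∑ e', w e e') (∑ e', v e e') + ∑ e', persp Φ (∑ e, w e e') (∑ e, v e e')
      ≤ ∑ e, ∑ e', persp Φ (w e e') (v e e')
        + persp Φ (∑ e, ∑ e', w e e') (∑ e, ∑ e', v e e') := by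
  have h0 : ∀ e e', 0 ≤ w e e' := fun e e' => (hc e e').1
  choose f hfD hf using fun e e' => (hc e e').2
  obtain rfl : v = fun e e' => w e e' * f e e' := by funext e e'; exact hf e e'
  set W := ∑ e, ∑ e', w e e' with hW
  have hWn : 0 ≤ W := Finset.sum_nonneg fun e _ => Finset.sum_nonneg fun e' _ => h0 e e'
  rcases hWn.eq_or_lt with hz | hpos
  · have hw1 : ∀ e, ∑ e', w e e' = 0 := fun e =>
      (Finset.sum_eq_zero_iff_of_nonneg fun e _ => Finset.sum_nonneg fun e' _ => h0 e e').mp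
        (hW.symm.trans hz.symm) e (Finset.mem_univ _)
    have hw2 : ∀ e e', w e e' = 0 := fun e e' =>
      (Finset.sum_eq_zero_iff_of_nonneg fun e' _ => h0 e e').mp (hw1 e) e' (Finset.mem_univ _)
    simp [hw2, ← hz]
  · let a : E → ℝ := fun e => (∑ e', w e e') / W
    let b : E' → ℝ := fun e' => (∑ e, w e e') / W
    have ha0 : ∀ e, 0 ≤ a e := fun e => div_nonneg (Finset.sum_nonneg fun e' _ => h0 e e') hWn
    have hb0 : ∀ e, 0 ≤ b e := fun e' => div_nonneg (Finset.sum_nonneg fun e _ => h0 e e') hWn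
    have ha1 : ∑ e, a e = 1 := by rw [← Finset.sum_div, ← hW, div_self hpos.ne']
    have hb1 : ∑ e, b e = 1 := by
      rw [← Finset.sum_div, Finset.sum_comm, ← hW, div_self hpos.ne']
    have hw : ∀ e e', w e e' = W * (a e * b e') := fun e e' => by
      have := hprod e e'
      simp only [a, b]
      field_simp
      linarith
    -- With `w = W a b`, the mixed difference is `W` times the Jensen gap, under `b`, of the
    -- `a`-entropy of the sections `f(·, e')`.
    have hcv := (h.convexOn_phiEntropy ha0 ha1).map_sum_le (t := Finset.univ) (w := b)
      (p := fun e' e => f e e') (fun e' _ => hb0 e') hb1 (fun e' _ e => hfD e e')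
    simp only [phiEntropy, Finset.sum_apply, Pi.smul_apply, smul_eq_mul] at hcv
    have t1 : ∀ e, persp Φ (∑ e', w e e') (∑ e', w e e' * f e e')
        = W * (a e * Φ (∑ e', b e' * f e e')) := fun e => by
      rw [← mul_assoc, ← persp_mul]
      congr 1
      · simp only [a]; field_simp
      · rw [Finset.mul_sum]
        exact Finset.sum_congr rfl fun e' _ => by rw [hw e e']; ring
    have t2 : ∀ e', persp Φ (∑ e, w e e') (∑ e, w e e' * f e e')
        = W * (b e' * Φ (∑ e, a e * f e e')) := fun e' => by
      rw [← mul_assoc, ← persp_mul]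
      congr 1
      · simp only [b]; field_simp
      · rw [Finset.mul_sum]
        exact Finset.sum_congr rfl fun e _ => by rw [hw e e']; ring
    have t3 : persp Φ W (∑ e, ∑ e', w e e' * f e e')
        = W * Φ (∑ e, a e * ∑ e', b e' * f e e') := by
      rw [← persp_mul]
      congr 1
      rw [Finset.mul_sum]
      refine Finset.sum_congr rfl fun e _ => ?_
      rw [Finset.mul_sum, Finset.mul_sum]
      exact Finset.sum_congr rfl fun e' _ => by rw [hw e e']; ring
    have t4 : ∑ e, ∑ e', persp Φ (w e e') (w e e' * f e e')
        = W * ∑ e', b e' * ∑ e, a e * Φ (f e e') := by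
      rw [Finset.sum_comm, Finset.mul_sum]
      refine Finset.sum_congr rfl fun e' _ => ?_
      rw [Finset.mul_sum, Finset.mul_sum]
      exact Finset.sum_congr rfl fun e _ => by rw [persp_mul, hw e e']; ring
    rw [t3, t4]
    simp only [t1, t2, ← Finset.mul_sum]
    simp only [mul_sub, Finset.sum_sub_distrib] at hcv
    rw [← mul_add, ← mul_add]
    exact mul_le_mul_of_nonneg_left (by linarith) hWn

/-! ### Entropies of conditional expectations as sums of perspectives -/

variable {A B : Type*} [Fintype A] [Fintype B]

lemma margA_mul_condA {p : A × B → ℝ} (hp : ∀ z, 0 ≤ p z) (f : A × B → ℝ) (a : A) :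
    margA p a * condA p f a = ∑ b, p (a, b) * f (a, b) := by
  rcases eq_or_ne (margA p a) 0 with h | h
  · have : ∀ b, p (a, b) = 0 := fun b =>
      (Finset.sum_eq_zero_iff_of_nonneg fun b _ => hp (a, b)).mp h b (Finset.mem_univ _)
    simp [h, this]
  · exact mul_div_cancel₀ _ h

lemma margB_mul_condB {p : A × B → ℝ} (hp : ∀ z, 0 ≤ p z) (f : A × B → ℝ) (b : B) :
    margB p b * condB p f b = ∑ a, p (a, b) * f (a, b) := by
  rcases eq_or_ne (margB p b) 0 with h | h
  · have : ∀ a, p (a, b) = 0 := fun a =>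
      (Finset.sum_eq_zero_iff_of_nonneg fun a _ => hp (a, b)).mp h a (Finset.mem_univ _)
    simp [h, this]
  · exact mul_div_cancel₀ _ h

lemma phiEntropy_condA {p : A × B → ℝ} (hp : ∀ z, 0 ≤ p z) (f : A × B → ℝ) :
    phiEntropy Φ (margA p) (condA p f)
      = ∑ a, persp Φ (∑ b, p (a, b)) (∑ b, p (a, b) * f (a, b)) - Φ (∑ z, p z * f z) := by
  simp only [phiEntropy, margA_mul_condA hp]
  rw [Fintype.sum_prod_type]
  rfl

lemma phiEntropy_condB {p : A × B → ℝ} (hp : ∀ z, 0 ≤ p z) (f : A × B → ℝ) :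
    phiEntropy Φ (margB p) (condB p f)
      = ∑ b, persp Φ (∑ a, p (a, b)) (∑ a, p (a, b) * f (a, b)) - Φ (∑ z, p z * f z) := by
  simp only [phiEntropy, margB_mul_condB hp]
  rw [Fintype.sum_prod_type_right]
  rfl

/-- Every pair with `l₁ + l₂ ≤ 1` belongs to the ribbon. -/
lemma mem_ribbon_of_add_le_one (hΦ : ConvexOn ℝ D Φ) {p : A × B → ℝ} (hp : ∀ z, 0 ≤ p z)
    (hp1 : ∑ z, p z = 1) {l : unitInterval × unitInterval} (hl : (l.1 : ℝ) + l.2 ≤ 1) :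
    l ∈ ribbon D Φ p := by
  intro f hf
  have hA : phiEntropy Φ (margA p) (condA p f) ≤ phiEntropy Φ p f := by
    rw [phiEntropy_condA hp, phiEntropy, Fintype.sum_prod_type (f := fun z => p z * Φ (f z))]
    refine sub_le_sub_right (Finset.sum_le_sum fun a _ => ?_) _
    simp only [← persp_mul]
    exact persp_sum_le hΦ _ fun b _ => ⟨hp _, f (a, b), hf _, rfl⟩
  have hB : phiEntropy Φ (margB p) (condB p f) ≤ phiEntropy Φ p f := by
    rw [phiEntropy_condB hp, phiEntropy, Fintype.sum_prod_type_right (f := fun z => p z * Φ (f z))]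
    refine sub_le_sub_right (Finset.sum_le_sum fun b _ => ?_) _
    simp only [← persp_mul]
    exact persp_sum_le hΦ _ fun a _ => ⟨hp _, f (a, b), hf _, rfl⟩
  have h0 : 0 ≤ phiEntropy Φ p f := by
    have := hΦ.map_sum_le (fun z _ => hp z) hp1 (fun z _ => hf z)
    simpa [phiEntropy] using this
  have := mul_le_mul_of_nonneg_left hA l.1.2.1
  have := mul_le_mul_of_nonneg_left hB l.2.2.1
  have := mul_le_mul_of_nonneg_right hl h0
  linarith

/-- The ribbon inequality for a multiple `c • p` of a probability distribution `p`. -/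
lemma persp_ribbon {p : A × B → ℝ} {l : unitInterval × unitInterval} (hl : l ∈ ribbon D Φ p)
    {c : ℝ} (hc : 0 ≤ c) {w v : A → B → ℝ} (hw : ∀ a b, w a b = c * p (a, b))
    (hp : ∀ z, 0 ≤ p z) (hp1 : ∑ z, p z = 1) (hcone : ∀ a b, InCone D (w a b) (v a b)) :
    (l.1 : ℝ) * (∑ a, persp Φ (∑ b, w a b) (∑ b, v a b)
        - persp Φ (∑ a, ∑ b, w a b) (∑ a, ∑ b, v a b))
      + (l.2 : ℝ) * (∑ b, persp Φ (∑ a, w a b) (∑ a, v a b)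
        - persp Φ (∑ a, ∑ b, w a b) (∑ a, ∑ b, v a b))
      ≤ ∑ a, ∑ b, persp Φ (w a b) (v a b)
        - persp Φ (∑ a, ∑ b, w a b) (∑ a, ∑ b, v a b) := by
  choose f hfD hf using fun a b => (hcone a b).2
  obtain rfl : v = fun a b => w a b * f a b := by funext a b; exact hf a b
  obtain rfl : w = fun a b => c * p (a, b) := by funext a b; exact hw a b
  rcases hc.eq_or_lt with rfl | hc
  · simp
  have key := hl (fun z => f z.1 z.2) fun z => hfD _ _
  rw [phiEntropy_condA hp, phiEntropy_condB hp, phiEntropy] at key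
  have hm : persp Φ (∑ a, ∑ b, p (a, b)) (∑ a, ∑ b, p (a, b) * f a b)
      = Φ (∑ z, p z * f z.1 z.2) := by
    rw [← Fintype.sum_prod_type', ← Fintype.sum_prod_type' (f := fun a b => p (a, b) * f a b)]
    simp only [hp1, persp, div_one, one_mul]
  rw [Fintype.sum_prod_type (f := fun z => p z * Φ (f z.1 z.2))] at key
  simp only [mul_assoc, ← Finset.mul_sum, persp_mul_mul hc.ne', ← mul_sub, hm]
  simp only [persp_mul]
  have := mul_le_mul_of_nonneg_left key hc.le
  linarith

end PhiRibbon

namespace PhiRibbon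

/-! ### The ribbon of the outputs of a pair of trees -/

namespace Branching

variable {G H : Type*} (T : Branching G) (S : Branching H)

lemma pairSum_comm (g : G) (h : H) (j k : ℕ) (ψ : G → H → ℝ) :
    T.pairSum S g h j k ψ = S.pairSum T h g k j (fun h g => ψ g h) := by
  induction j generalizing ψ with
  | zero => simp only [pairSum_apply, pow_zero, Module.End.one_apply]
  | succ j ih => rw [pairSum_succ_left, ih, pairSum_succ_right]

lemma pairSum_succ_left' (g : G) (h : H) (j k : ℕ) (ψ : G → H → ℝ) :
    T.pairSum S g h (j + 1) k ψ = ∑ e, T.pairSum S (T.step g e) h j k ψ := by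
  simp only [pairSum_apply, sum_pow_succ_apply]

lemma pairSum_succ_right' (g : G) (h : H) (j k : ℕ) (ψ : G → H → ℝ) :
    T.pairSum S g h j (k + 1) ψ = ∑ e, T.pairSum S g (S.step h e) j k ψ := by
  rw [pairSum_comm, pairSum_succ_left']
  simp only [← pairSum_comm T S]

lemma pairSum_eq_self {W : G → H → ℝ} (hA : ∀ g h, ∑ e, W (T.step g e) h = W g h)
    (hB : ∀ g h, ∑ e, W g (S.step h e) = W g h) (g : G) (h : H) (j k : ℕ) :
    T.pairSum S g h j k W = W g h := by
  induction j generalizing k with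
  | zero =>
    induction k with
    | zero => rw [pairSum_zero_zero]
    | succ k ih => simp only [pairSum_succ_right, hB]; exact ih
  | succ j ih => simp only [pairSum_succ_left, hA]; exact ih k

variable {D : Set ℝ} {Φ : ℝ → ℝ}

lemma inCone_pairSum (hD : Convex ℝ D) (hne : D.Nonempty) {w v : G → H → ℝ}
    (hc : ∀ g h, InCone D (w g h) (v g h)) (g : G) (h : H) (j k : ℕ) :
    InCone D (T.pairSum S g h j k w) (T.pairSum S g h j k v) := by
  induction j generalizing k w v with
  | zero =>
    induction k generalizing w v with
    | zero => simpa only [pairSum_zero_zero] using hc g h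
    | succ k ih =>
      simp only [pairSum_succ_right]
      exact ih fun g h => InCone.sum hD hne _ fun e _ => hc _ _
  | succ j ih =>
    simp only [pairSum_succ_left]
    exact ih (fun g h => InCone.sum hD hne _ fun e _ => hc _ _) k

lemma persp_pairSum_le (hΦ : ConvexOn ℝ D Φ) (hne : D.Nonempty) {w v : G → H → ℝ}
    (hc : ∀ g h, InCone D (w g h) (v g h)) (g : G) (h : H) (j k : ℕ) :
    persp Φ (T.pairSum S g h j k w) (T.pairSum S g h j k v)
      ≤ T.pairSum S g h j k (fun g h => persp Φ (w g h) (v g h)) := by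
  induction j generalizing k w v with
  | zero =>
    induction k generalizing w v with
    | zero => simp only [pairSum_zero_zero]; exact le_rfl
    | succ k ih =>
      simp only [pairSum_succ_right]
      refine (ih fun g h => InCone.sum hΦ.1 hne _ fun e _ => hc _ _).trans ?_
      exact T.pairSum_mono S _ _ (fun g h => persp_sum_le hΦ _ fun e _ => hc _ _) _ _
  | succ j ih =>
    simp only [pairSum_succ_left]
    refine (ih (fun g h => InCone.sum hΦ.1 hne _ fun e _ => hc _ _) k).trans ?_
    exact T.pairSum_mono S _ _ (fun g h => persp_sum_le hΦ _ fun e _ => hc _ _) _ _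

variable {O O' : Type*} (g₀ : G) (h₀ : H) (N : ℕ) (W : G → H → ℝ)
  (outA : G → O) (outB : H → O')

open Classical in
/-- The joint law of the outputs of the states that are reached after `N` steps. -/
noncomputable def outLaw (a : O) (b : O') : ℝ :=
  T.pairSum S g₀ h₀ N N (fun g h => if outA g = a ∧ outB h = b then W g h else 0)

/-- Exchanging the parties lets `sum_persp_outLaw_le` serve for the second output too. -/
lemma outLaw_comm (a : O) (b : O') : T.outLaw S g₀ h₀ N W outA outB a b
    = S.outLaw T h₀ g₀ N (fun h g => W g h) outB outA b a := by
  classical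
  simp only [outLaw]
  rw [pairSum_comm]
  congr 1
  funext h g
  exact if_congr and_comm rfl rfl

lemma pairSum_mul_out [Fintype O] [Fintype O'] (F : O → O' → ℝ) :
    T.pairSum S g₀ h₀ N N (fun g h => W g h * F (outA g) (outB h))
      = ∑ a, ∑ b, T.outLaw S g₀ h₀ N W outA outB a b * F a b := by
  classical
  have : (fun g h => W g h * F (outA g) (outB h))
      = ∑ a, ∑ b, F a b • fun g h => if outA g = a ∧ outB h = b then W g h else 0 := by
    funext g h
    simp only [Finset.sum_apply, Pi.smul_apply, smul_eq_mul, ite_and, mul_ite, mul_zero]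
    simp [mul_comm]
  rw [this]
  simp only [map_sum, map_smul, smul_eq_mul, outLaw]
  refine Finset.sum_congr rfl fun a _ => Finset.sum_congr rfl fun b _ => ?_
  rw [mul_comm]

/-- Data processing: the conditional expectation given the output of the first party has a smaller
`Φ`-entropy than the one given the state. -/
lemma sum_persp_outLaw_le [Fintype O] [Fintype O'] (hΦ : ConvexOn ℝ D Φ) (hne : D.Nonempty)
    (hW : ∀ g h, 0 ≤ W g h) (hB : ∀ g h, ∑ e, W g (S.step h e) = W g h) {f : O → O' → ℝ}
    (hf : ∀ a b, f a b ∈ D) :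
    ∑ a, persp Φ (∑ b, T.outLaw S g₀ h₀ N W outA outB a b)
        (∑ b, T.outLaw S g₀ h₀ N W outA outB a b * f a b)
      ≤ T.pairSum S g₀ h₀ N 0 (fun g h => persp Φ (W g h)
          (T.pairSum S g h 0 N (fun g h => W g h * f (outA g) (outB h)))) := by
  classical
  let V : G → H → ℝ := fun g h => T.pairSum S g h 0 N (fun g h => W g h * f (outA g) (outB h))
  have hWN : ∀ g h, T.pairSum S g h 0 N W = W g h := by
    intro g h
    induction N with
    | zero => rw [pairSum_zero_zero]
    | succ k ih => simp only [pairSum_succ_right, hB]; exact ih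
  have hcone : ∀ g h, InCone D (W g h) (V g h) := fun g h => by
    rw [← hWN]
    exact T.inCone_pairSum S hΦ.1 hne (fun g h => ⟨hW g h, _, hf _ _, rfl⟩) g h 0 N
  have hsplit : (fun g h => persp Φ (W g h) (V g h)) = ∑ a : O, fun g h =>
      persp Φ (if outA g = a then W g h else 0) (if outA g = a then V g h else 0) := by
    funext g h
    simp only [Finset.sum_apply]
    rw [Finset.sum_eq_single (outA g)]
    · simp
    · intro a _ ha
      simp [Ne.symm ha]
    · simp
  change _ ≤ T.pairSum S g₀ h₀ N 0 (fun g h => persp Φ (W g h) (V g h))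
  rw [hsplit, map_sum]
  refine Finset.sum_le_sum fun a _ => ?_
  -- The indicator depends on the first party's state only, so it commutes with the second party's
  -- sum.
  have hgather : ∀ ψ : G → H → ℝ,
      T.pairSum S g₀ h₀ N 0 (fun g h => if outA g = a then T.pairSum S g h 0 N ψ else 0)
        = T.pairSum S g₀ h₀ N N (fun g h => if outA g = a then ψ g h else 0) := by
    intro ψ
    simp only [pairSum_apply, pow_zero, Module.End.one_apply]
    refine congrFun (congrArg _ (funext fun g => ?_)) g₀
    by_cases hg : outA g = a
    · simp [hg]
    · have : (fun h : H => (0 : ℝ)) = 0 := rfl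
      simp [hg, this]
  have e1 : T.pairSum S g₀ h₀ N 0 (fun g h => if outA g = a then W g h else 0)
      = ∑ b, T.outLaw S g₀ h₀ N W outA outB a b := by
    have := hgather W
    simp only [hWN] at this
    rw [this]
    simp only [outLaw]
    rw [← map_sum]
    congr 1
    funext g h
    simp only [Finset.sum_apply, ite_and]
    simp
  have e2 : T.pairSum S g₀ h₀ N 0 (fun g h => if outA g = a then V g h else 0)
      = ∑ b, T.outLaw S g₀ h₀ N W outA outB a b * f a b := by
    rw [hgather]
    have := T.pairSum_mul_out S g₀ h₀ N W outA outB (fun a' b => if a' = a then f a b else 0)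
    have h2 : ∑ a', ∑ b, T.outLaw S g₀ h₀ N W outA outB a' b * (if a' = a then f a b else 0)
        = ∑ b, T.outLaw S g₀ h₀ N W outA outB a b * f a b := by
      rw [Finset.sum_eq_single a]
      · simp
      · intro a' _ ha'
        simp [ha']
      · simp
    rw [← h2, ← this]
    congr 1
    funext g h
    split_ifs with hg
    · rw [hg]
    · simp
  rw [← e1, ← e2]
  refine T.persp_pairSum_le S hΦ hne (fun g h => ?_) _ _ _ _
  split_ifs
  · exact hcone g h
  · obtain ⟨d, hd⟩ := hne
    exact ⟨le_rfl, d, hd, by simp⟩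

/-- The consistent weight `W` makes the conditional expectations of `f` a martingale in each tree.
Perspectives of these feed `ribbon_inequality_of_local`, and data processing passes from the final
states to the outputs. -/
theorem mem_ribbon_outLaw [Fintype O] [Fintype O'] (hΦ : IsClassF D Φ)
    (M aliveA aliveB : G → H → Prop) {l : unitInterval × unitInterval}
    (hl : 1 ≤ (l.1 : ℝ) + l.2) (hW : ∀ g h, 0 ≤ W g h) (hW1 : W g₀ h₀ = 1)
    (hWA : ∀ g h, ∑ e, W (T.step g e) h = W g h) (hWB : ∀ g h, ∑ e, W g (S.step h e) = W g h)
    (hU : ∀ g h, ¬ M g h → ∀ e e', W (T.step g e) (S.step h e') * W g h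
      = W (T.step g e) h * W g (S.step h e'))
    (hM : ∀ g h, M g h → ∀ v : T.Next g → S.Next h → ℝ,
      (∀ e e', InCone D (W (T.step g e) (S.step h e')) (v e e')) →
      (l.1 : ℝ) * (∑ e, persp Φ (W (T.step g e) h) (∑ e', v e e')
          - persp Φ (W g h) (∑ e, ∑ e', v e e'))
        + (l.2 : ℝ) * (∑ e', persp Φ (W g (S.step h e')) (∑ e, v e e')
          - persp Φ (W g h) (∑ e, ∑ e', v e e'))
        ≤ ∑ e, ∑ e', persp Φ (W (T.step g e) (S.step h e')) (v e e')
          - persp Φ (W g h) (∑ e, ∑ e', v e e'))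
    (hMA : ∀ g h, M g h → aliveA g h) (hMB : ∀ g h, M g h → aliveB g h)
    (hA : ∀ g h e, aliveA g (S.step h e) ↔ aliveA g h ∧ ¬ M g h)
    (hB : ∀ g h e, aliveB (T.step g e) h ↔ aliveB g h ∧ ¬ M g h) :
    l ∈ ribbon D Φ (fun z : O × O' => T.outLaw S g₀ h₀ N W outA outB z.1 z.2) := by
  intro f hf
  have hne : D.Nonempty := hΦ.nonempty_interior.mono interior_subset
  have hD := hΦ.convexOn.1
  let L : G → H → ℝ := fun g h => W g h * f (outA g, outB h)
  -- `V j k g h` is `W g h` times the conditional expectation of `f` given the states `g` and `h`,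
  -- with `N - j` and `N - k` steps still to go.
  let V : ℕ → ℕ → G → H → ℝ := fun j k g h => T.pairSum S g h (N - j) (N - k) L
  have hVA : ∀ j k g h, j < N → ∑ e, V (j + 1) k (T.step g e) h = V j k g h := by
    intro j k g h hj
    have : N - j = N - (j + 1) + 1 := by omega
    simp only [V]
    rw [this, pairSum_succ_left']
  have hVB : ∀ j k g h, k < N → ∑ e, V j (k + 1) g (S.step h e) = V j k g h := by
    intro j k g h hk
    have : N - k = N - (k + 1) + 1 := by omega
    simp only [V]
    rw [this, pairSum_succ_right']
  have hcone : ∀ j k g h, InCone D (W g h) (V j k g h) := fun j k g h => by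
    rw [← T.pairSum_eq_self S hWA hWB g h (N - j) (N - k)]
    exact T.inCone_pairSum S hD hne (fun g h => ⟨hW g h, _, hf _, rfl⟩) g h _ _
  let Ψ : ℕ → ℕ → G → H → ℝ := fun j k g h => persp Φ (W g h) (V j k g h)
  have main := T.ribbon_inequality_of_local S g₀ h₀ N Ψ M aliveA aliveB l.1.2.2 l.2.2.2 hl
    (fun j k g h hj _ => by
      simp only [Ψ]
      rw [← hWA, ← hVA j k g h hj]
      exact persp_sum_le hΦ.convexOn _ fun e _ => hcone _ _ _ _)
    (fun j k g h _ hk => by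
      simp only [Ψ]
      rw [← hWB, ← hVB j k g h hk]
      exact persp_sum_le hΦ.convexOn _ fun e _ => hcone _ _ _ _)
    (fun j k g h hj hk hm => by
      have := hΦ.persp_mixed_difference_nonneg
        (w := fun e e' => W (T.step g e) (S.step h e'))
        (v := fun e e' => V (j + 1) (k + 1) (T.step g e) (S.step h e'))
        (fun e e' => hcone _ _ _ _) (fun e e' => by
          simp only [hWA, hWB]
          exact hU g h hm e e')
      simpa only [hWA, hWB, hVA _ _ _ _ hj, hVB _ _ _ _ hk] using this)
    (fun j k g h hj hk hm => by
      have := hM g h hm (fun e e' => V (j + 1) (k + 1) (T.step g e) (S.step h e'))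
        (fun e e' => hcone _ _ _ _)
      have hsw : ∀ e', ∑ e, V (j + 1) (k + 1) (T.step g e) (S.step h e')
          = V j (k + 1) g (S.step h e') := fun e' => hVA _ _ _ _ hj
      simpa only [hsw, hVA _ _ _ _ hj, hVB _ _ _ _ hk] using this)
    hMA hMB hA hB
  let q : O × O' → ℝ := fun z => T.outLaw S g₀ h₀ N W outA outB z.1 z.2
  have hq0 : ∀ z, 0 ≤ q z := fun z => T.pairSum_nonneg S g₀ h₀ (fun g h => by
    split_ifs
    · exact hW g h
    · exact le_rfl) _ _
  have hmean : V 0 0 g₀ h₀ = ∑ z, q z * f z := by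
    have := T.pairSum_mul_out S g₀ h₀ N W outA outB (fun a b => f (a, b))
    rw [Fintype.sum_prod_type]
    exact this
  have h00 : Ψ 0 0 g₀ h₀ = Φ (∑ z, q z * f z) := by
    simp only [Ψ, hW1, hmean, persp, div_one, one_mul]
  have hNN : T.pairSum S g₀ h₀ N N (Ψ N N) = ∑ z, q z * Φ (f z) := by
    have := T.pairSum_mul_out S g₀ h₀ N W outA outB (fun a b => Φ (f (a, b)))
    rw [Fintype.sum_prod_type]
    refine Eq.trans ?_ this
    congr 1
    funext g h
    simp only [Ψ, V, Nat.sub_self, pairSum_zero_zero, L, persp_mul]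
  have hN0 : ∑ a, persp Φ (∑ b, q (a, b)) (∑ b, q (a, b) * f (a, b))
      ≤ T.pairSum S g₀ h₀ N 0 (Ψ N 0) := by
    have := T.sum_persp_outLaw_le S g₀ h₀ N W outA outB hΦ.convexOn hne hW hWB
      (f := fun a b => f (a, b)) (fun a b => hf _)
    refine this.trans (le_of_eq ?_)
    simp only [Ψ, V, Nat.sub_self, Nat.sub_zero, L]
  have h0N : ∑ b, persp Φ (∑ a, q (a, b)) (∑ a, q (a, b) * f (a, b))
      ≤ T.pairSum S g₀ h₀ 0 N (Ψ 0 N) := by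
    have := S.sum_persp_outLaw_le T h₀ g₀ N (fun h g => W g h) outB outA hΦ.convexOn hne
      (fun h g => hW g h) (fun h g => hWA g h) (f := fun b a => f (a, b)) (fun a b => hf _)
    simp only [← T.outLaw_comm S] at this
    refine this.trans (le_of_eq ?_)
    rw [T.pairSum_comm S]
    congr 1
    funext h g
    simp only [Ψ, V, Nat.sub_self, Nat.sub_zero, L]
    rw [T.pairSum_comm S]
  rw [phiEntropy_condA hq0, phiEntropy_condB hq0, phiEntropy]
  rw [h00, hNN] at main
  -- Nonnegativity of `l₁` and `l₂` allows the terms for the full final states to be replaced by the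
  -- smaller ones for the outputs.
  have m1 := mul_le_mul_of_nonneg_left hN0 l.1.2.1
  have m2 := mul_le_mul_of_nonneg_left h0N l.2.2.1
  simp only [q] at *
  linarith

end Branching

end PhiRibbon

namespace PhiRibbon

/-! ### The decision tree of one party -/

open scoped NNReal

universe uX uA uO uU

section Tree

variable {n : ℕ} {X : Fin n → Type uX} {A : Fin n → Type uA} {O : Type uO} {U : Type uU}

/-- A state of one party: a transcript `h`, together with the probability `w` of the choices made
so far and, if such is the case, the box and the input that have been chosen but not yet answered,
or the final output. -/
inductive Node (X : Fin n → Type uX) (A : Fin n → Type uA) (O : Type uO) where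
  | idle (w : ℝ≥0) (h : History X A)
  | pend (w : ℝ≥0) (h : History X A) (i : Fin n) (x : X i)
  | fin (w : ℝ≥0) (h : History X A) (o : O)

namespace Node

/-- The transcript of a state. -/
def hist : Node X A O → History X A
  | idle _ h => h
  | pend _ h _ _ => h
  | fin _ h _ => h

/-- The product of the probabilities of the choices made. -/
def weight : Node X A O → ℝ≥0
  | idle w _ => w
  | pend w _ _ _ => w
  | fin w _ _ => w

/-- The box that has been chosen and not yet answered. -/
def pending : Node X A O → Option (Fin n)
  | idle _ _ => none
  | pend _ _ i _ => some i
  | fin _ _ _ => none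

/-- The final output, if there is one. -/
noncomputable def out [Nonempty O] : Node X A O → O
  | idle _ _ => Classical.arbitrary O
  | pend _ _ _ _ => Classical.arbitrary O
  | fin _ _ o => o

/-- The weight of a state in which no box is used twice, and `0` for all other states. -/
noncomputable def mass (g : Node X A O) : ℝ :=
  if (g.pending.toList ++ g.hist.keys).Nodup then g.weight else 0

lemma mass_nonneg (g : Node X A O) : 0 ≤ g.mass := by
  unfold mass; split_ifs
  · exact g.weight.2
  · exact le_rfl

lemma mass_idle (w : ℝ≥0) (h : History X A) :
    (idle w h : Node X A O).mass = if h.keys.Nodup then (w : ℝ) else 0 := rfl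

lemma mass_fin (w : ℝ≥0) (h : History X A) (o : O) :
    (fin w h o : Node X A O).mass = if h.keys.Nodup then (w : ℝ) else 0 := rfl

lemma mass_pend (w : ℝ≥0) (h : History X A) (i : Fin n) (x : X i) :
    (pend w h i x : Node X A O).mass = if i ∉ h.keys ∧ h.keys.Nodup then (w : ℝ) else 0 := by
  simp [mass, pending, hist, weight, List.nodup_cons]

lemma mass_idle_append (w : ℝ≥0) (h : History X A) (i : Fin n) (x : X i) (a : A i) :
    (idle w (h ++ [⟨i, x, a⟩]) : Node X A O).mass = (pend w h i x : Node X A O).mass := by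
  rw [mass_idle, mass_pend, List.keys_append]
  refine if_congr ?_ rfl rfl
  rw [List.nodup_append_comm]
  exact List.nodup_cons

lemma notMem_keys_of_mass_ne_zero {g : Node X A O} (hg : g.mass ≠ 0) {i : Fin n}
    (hi : g.pending = some i) : i ∉ g.hist.keys := by
  unfold mass at hg
  rw [hi] at hg
  have : (i :: g.hist.keys).Nodup := by
    by_contra hc
    exact hg (if_neg hc)
  exact (List.nodup_cons.mp this).1

end Node

variable [∀ i, Fintype (X i)] [∀ i, Fintype (A i)] [Fintype O] (σ : Strategy X A U O) (u : U)

/-- The probability of a choice, `0` if all boxes have been used. -/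
noncomputable def Strategy.chooseProb (h : History X A) (c : Σ i, X i) : ℝ≥0 :=
  if h.length < n then (σ.choose u h c).toNNReal else 0

/-- The probability of an output, `0` if some box has not been used. -/
noncomputable def Strategy.outputProb (h : History X A) (o : O) : ℝ≥0 :=
  if h.length < n then 0 else (σ.output u h o).toNNReal

lemma Strategy.coe_chooseProb (h : History X A) (c : Σ i, X i) :
    (σ.chooseProb u h c : ℝ) = if h.length < n then σ.choose u h c else 0 := by
  unfold chooseProb; split_ifs
  · exact Real.coe_toNNReal _ (σ.choose_nonneg u h c)
  · rfl

lemma Strategy.coe_outputProb (h : History X A) (o : O) :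
    (σ.outputProb u h o : ℝ) = if h.length < n then 0 else σ.output u h o := by
  unfold outputProb; split_ifs
  · rfl
  · exact Real.coe_toNNReal _ (σ.output_nonneg u h o)

/-- The possible next events in a state: the choice of a box and an input (or of an output), the
answer of the chosen box, nothing. -/
def Node.Next : Node X A O → Type (max uX uA uO)
  | .idle _ _ => ULift.{uA} ((Σ i, X i) ⊕ O)
  | .pend _ _ i _ => ULift.{max uX uO} (A i)
  | .fin _ _ _ => PUnit

/-- The decision tree of a party. -/
noncomputable def Strategy.tree : Branching (Node X A O) where
  Next := Node.Next
  fintype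
    | .idle _ _ => inferInstanceAs (Fintype (ULift ((Σ i, X i) ⊕ O)))
    | .pend _ _ i _ => inferInstanceAs (Fintype (ULift (A i)))
    | .fin _ _ _ => inferInstanceAs (Fintype PUnit)
  step
    | .idle w h, ⟨.inl c⟩ => .pend (w * σ.chooseProb u h c) h c.1 c.2
    | .idle w h, ⟨.inr o⟩ => .fin (w * σ.outputProb u h o) h o
    | .pend w h i x, ⟨a⟩ => .idle w (h ++ [⟨i, x, a⟩])
    | .fin w h o, _ => .fin w h o

lemma sum_ulift {α : Type*} [Fintype α] (F : ULift α → ℝ) : ∑ e, F e = ∑ a, F ⟨a⟩ :=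
  (Equiv.ulift.symm.sum_comp F).symm

lemma Strategy.tree_sum_idle (φ : Node X A O → ℝ) (w : ℝ≥0) (h : History X A) :
    (σ.tree u).sum φ (.idle w h) = ∑ c, φ (.pend (w * σ.chooseProb u h c) h c.1 c.2)
      + ∑ o, φ (.fin (w * σ.outputProb u h o) h o) := by
  exact (sum_ulift _).trans
    (Fintype.sum_sum_type (fun e => φ ((σ.tree u).step (.idle w h) ⟨e⟩)))

lemma Strategy.tree_sum_pend (φ : Node X A O → ℝ) (w : ℝ≥0) (h : History X A) (i : Fin n)
    (x : X i) : (σ.tree u).sum φ (.pend w h i x) = ∑ a, φ (.idle w (h ++ [⟨i, x, a⟩])) :=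
  sum_ulift _

lemma Strategy.tree_sum_fin (φ : Node X A O → ℝ) (w : ℝ≥0) (h : History X A) (o : O) :
    (σ.tree u).sum φ (.fin w h o) = φ (.fin w h o) :=
  Fintype.sum_unique (ι := PUnit) fun _ => φ (.fin w h o)

lemma Strategy.keys_hist_step (g : Node X A O) (e : (σ.tree u).Next g) :
    ((σ.tree u).step g e).hist.keys = g.hist.keys ++ g.pending.toList := by
  match g, e with
  | .idle w h, ⟨.inl c⟩ => simp [tree, Node.hist, Node.pending]
  | .idle w h, ⟨.inr o⟩ => simp [tree, Node.hist, Node.pending]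
  | .pend w h i x, ⟨a⟩ => simp [tree, Node.hist, Node.pending, List.keys]
  | .fin w h o, _ => simp [tree, Node.hist, Node.pending]

/-- An event can change only the entry of the pending box; this is the source of independence at
unmatched pairs. -/
lemma Strategy.dlookup_hist_step {g : Node X A O} (e : (σ.tree u).Next g) {i : Fin n}
    (hi : g.pending ≠ some i) :
    ((σ.tree u).step g e).hist.dlookup i = g.hist.dlookup i := by
  match g, e with
  | .idle w h, ⟨.inl c⟩ => rfl
  | .idle w h, ⟨.inr o⟩ => rfl
  | .pend w h j x, ⟨a⟩ =>
    have hij : i ≠ j := fun hc => hi (by rw [hc]; rfl)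
    change List.dlookup i (h ++ [⟨j, x, a⟩]) = List.dlookup i h
    rw [List.dlookup_append, List.dlookup_cons_ne _ _ hij, List.dlookup_nil, Option.or_none]
  | .fin w h o, _ => rfl

/-- A state of mass zero has only successors of mass zero, because neither a repeated box nor a zero
weight is ever undone. Elsewhere divide. -/
lemma Strategy.exists_mass_step (g : Node X A O) (e : (σ.tree u).Next g) :
    ∃ c : ℝ, ((σ.tree u).step g e).mass = g.mass * c := by
  rcases eq_or_ne g.mass 0 with hg | hg
  swap
  · exact ⟨((σ.tree u).step g e).mass / g.mass, (mul_div_cancel₀ _ hg).symm⟩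
  refine ⟨0, ?_⟩
  rw [mul_zero]
  match g, e with
  | .idle w h, ⟨.inl c⟩ =>
    change (Node.pend _ _ _ _).mass = 0
    rw [Node.mass_idle] at hg
    rw [Node.mass_pend]
    split_ifs at hg with hn
    · simp [hg]
    · simp [hn]
  | .idle w h, ⟨.inr o⟩ =>
    change (Node.fin _ _ _).mass = 0
    rw [Node.mass_idle] at hg
    rw [Node.mass_fin]
    split_ifs at hg with hn
    · simp [hg]
    · simp [hn]
  | .pend w h i x, ⟨a⟩ =>
    exact (Node.mass_idle_append w h i x a).trans hg
  | .fin w h o, _ => exact hg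

/-- The masses of the successors of a state, weighted by a function of the transcripts that is
consistent under taking the answer of a box, sum up to the mass of the state. -/
lemma Strategy.sum_mass_step {θ : History X A → ℝ}
    (hθ : ∀ h i x, i ∉ h.keys → ∑ a, θ (h ++ [⟨i, x, a⟩]) = θ h) (g : Node X A O) :
    ∑ e, ((σ.tree u).step g e).mass * θ ((σ.tree u).step g e).hist = g.mass * θ g.hist := by
  change (σ.tree u).sum (fun g => g.mass * θ g.hist) g = _
  match g with
  | .idle w h =>
    rw [tree_sum_idle]
    simp only [Node.mass_idle, Node.mass_pend, Node.mass_fin, Node.hist, ← Finset.sum_mul,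
      ← add_mul]
    congr 1
    by_cases hn : h.keys.Nodup
    · simp only [hn, and_true, if_true]
      -- Exactly one kind of event carries weight: choices while fewer than `n` actions are done,
      -- outputs afterwards. Used boxes get choice probability zero, so the indicator in the mass
      -- loses nothing.
      by_cases hlt : h.length < n
      · simp only [NNReal.coe_mul, coe_chooseProb, coe_outputProb, hlt, if_true, mul_zero,
          Finset.sum_const_zero, add_zero]
        calc _ = ∑ c, (w : ℝ) * σ.choose u h c := by
              refine Finset.sum_congr rfl fun c _ => ?_
              split_ifs with hc
              · rw [σ.choose_used u h c hc, mul_zero]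
              · rfl
          _ = w := by rw [← Finset.mul_sum, σ.choose_sum u h hn hlt, mul_one]
      -- A transcript without repetitions has at most `n` entries, so here it is complete and
      -- `output_sum` applies.
      · have hlen : h.length = n := by
          have : h.keys.length ≤ n := by simpa using hn.length_le_card
          rw [List.keys, List.length_map] at this
          omega
        simp only [NNReal.coe_mul, coe_chooseProb, coe_outputProb, hlt, if_false, mul_zero,
          ite_self, Finset.sum_const_zero, zero_add]
        rw [← Finset.mul_sum, σ.output_sum u h hn hlen, mul_one]
    · simp [hn]
  | .pend w h i x =>
    rw [tree_sum_pend]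
    simp only [Node.mass_idle_append, Node.hist, ← Finset.mul_sum]
    by_cases hi : i ∈ h.keys
    · simp [Node.mass_pend, hi]
    · rw [hθ h i x hi]
  | .fin w h o => rw [tree_sum_fin]

end Tree

end PhiRibbon

namespace PhiRibbon

open scoped NNReal

universe uX uA uO uU

/-! ### The law of the runs of one party -/

section Runs

variable {n : ℕ} {X : Fin n → Type uX} {A : Fin n → Type uA} {O : Type uO} {U : Type uU}

/-- The sequence of the actions of a run. -/
def Run.actions (t : Run X A) (j : Fin n) : Σ i, X i × A i :=
  ⟨t.1 j, t.2.1 (t.1 j), t.2.2 (t.1 j)⟩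

lemma Run.history_eq_take (t : Run X A) (k : ℕ) :
    t.history k = (List.ofFn t.actions).take k := by
  rw [List.ofFn_eq_map, ← List.map_take]; rfl

lemma Run.history_self (t : Run X A) : t.history n = List.ofFn t.actions := by
  rw [history_eq_take, List.take_of_length_le (by simp)]

lemma Run.actions_injective : Function.Injective (Run.actions : Run X A → _) := by
  rintro ⟨π, x, a⟩ ⟨π', x', a'⟩ h
  obtain rfl : π = π' := Equiv.ext fun j => congrArg Sigma.fst (congrFun h j)
  have hi : ∀ i, x i = x' i ∧ a i = a' i := fun i => by
    obtain ⟨j, rfl⟩ := π.surjective i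
    simpa [actions] using congrFun h j
  obtain rfl : x = x' := funext fun i => (hi i).1
  obtain rfl : a = a' := funext fun i => (hi i).2
  rfl

lemma nodup_keys_ofFn {m : ℕ} (v : Fin m → Σ i, X i × A i) :
    (List.ofFn v).keys.Nodup ↔ Function.Injective fun j => (v j).1 := by
  rw [List.keys, List.map_ofFn, List.nodup_ofFn]
  rfl

lemma Run.nodup_keys_actions (t : Run X A) : (List.ofFn t.actions).keys.Nodup :=
  (nodup_keys_ofFn _).mpr t.1.injective

lemma Run.exists_actions_eq {v : Fin n → Σ i, X i × A i}
    (hv : Function.Injective fun j => (v j).1) :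
    ∃ t : Run X A, t.actions = v := by
  have hb := Finite.injective_iff_bijective.mp hv
  have : ∀ i, ∃ r : X i × A i, ∃ j, v j = ⟨i, r⟩ := fun i => by
    obtain ⟨j, rfl⟩ := hb.2 i
    exact ⟨(v j).2, j, rfl⟩
  choose r k hr using this
  refine ⟨⟨Equiv.ofBijective _ hb, fun i => (r i).1, fun i => (r i).2⟩, funext fun j => ?_⟩
  have hk : k (v j).1 = j := hv (by simp only [hr])
  have := hr (v j).1
  rw [hk] at this
  exact this.symm

lemma Run.dlookup_history (t : Run X A) (i : Fin n) :
    (t.history n).dlookup i = some (t.2.1 i, t.2.2 i) := by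
  rw [history_self]
  refine List.mem_dlookup t.nodup_keys_actions ?_
  rw [List.mem_ofFn]
  obtain ⟨j, rfl⟩ := t.1.surjective i
  exact ⟨j, rfl⟩

variable [∀ i, Fintype (X i)] [∀ i, Fintype (A i)] [Fintype O] (σ : Strategy X A U O) (u : U)

/-- The product of the probabilities of the choices along a sequence of actions. -/
noncomputable def Strategy.pathWeight {m : ℕ} (v : Fin m → Σ i, X i × A i) : ℝ≥0 :=
  ∏ j : Fin m, σ.chooseProb u ((List.ofFn v).take j) ⟨(v j).1, (v j).2.1⟩

lemma Strategy.pathWeight_snoc {m : ℕ} (v : Fin m → Σ i, X i × A i) (e : Σ i, X i × A i) :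
    σ.pathWeight u (Fin.snoc v e : Fin (m + 1) → Σ i, X i × A i)
      = σ.pathWeight u v * σ.chooseProb u (List.ofFn v) ⟨e.1, e.2.1⟩ := by
  have hof : List.ofFn (Fin.snoc v e : Fin (m + 1) → Σ i, X i × A i) = List.ofFn v ++ [e] := by
    rw [List.ofFn_succ', List.concat_eq_append]
    simp
  rw [pathWeight, Fin.prod_univ_castSucc, hof]
  congr 1
  · refine Finset.prod_congr rfl fun j _ => ?_
    rw [Fin.snoc_castSucc, Fin.val_castSucc, List.take_append_of_le_length (by simp [j.2.le])]
  · rw [Fin.snoc_last, Fin.val_last]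
    congr 1
    rw [List.take_append_of_le_length (by simp), List.take_of_length_le (by simp)]

lemma Strategy.pathWeight_actions (t : Run X A) :
    (σ.pathWeight u t.actions : ℝ) = σ.choiceWeight u t := by
  rw [pathWeight, NNReal.coe_prod, choiceWeight]
  refine Finset.prod_congr rfl fun j _ => ?_
  rw [coe_chooseProb, if_pos (by simp), Run.history_eq_take]
  rfl

/-- Weight zero is inherited, so premature outputs and superfluous choices can be dropped at every
depth. -/
lemma Strategy.tree_sum_eq_zero {φ : Node X A O → ℝ}
    (hφ : ∀ g : Node X A O, g.weight = 0 → φ g = 0) (g : Node X A O) (hg : g.weight = 0) :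
    (σ.tree u).sum φ g = 0 := by
  match g with
  | .idle w h =>
    obtain rfl : w = 0 := hg
    rw [tree_sum_idle]
    simp [hφ _ (show (Node.pend 0 h _ _ : Node X A O).weight = 0 from rfl),
      hφ _ (show (Node.fin 0 h _ : Node X A O).weight = 0 from rfl)]
  | .pend w h i x =>
    rw [tree_sum_pend]
    exact Finset.sum_eq_zero fun a _ => hφ _ hg
  | .fin w h o =>
    rw [tree_sum_fin]
    exact hφ _ hg

/-- After `2 m` steps, the party has taken `m` complete actions. -/
lemma Strategy.tree_sum_pow_two_mul (m : ℕ) (hm : m ≤ n) (φ : Node X A O → ℝ)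
    (hφ : ∀ g : Node X A O, g.weight = 0 → φ g = 0) :
    ((σ.tree u).sum ^ (2 * m)) φ (.idle 1 [])
      = ∑ v : Fin m → Σ i, X i × A i, φ (.idle (σ.pathWeight u v) (List.ofFn v)) := by
  induction m generalizing φ with
  | zero => simp [pathWeight]
  | succ m ih =>
    rw [Nat.mul_succ, pow_add, pow_two, Module.End.mul_apply, Module.End.mul_apply,
      ih (by omega) _ (σ.tree_sum_eq_zero u (σ.tree_sum_eq_zero u hφ)),
      ← (Fin.snocEquiv fun _ : Fin (m + 1) => Σ i, X i × A i).sum_comp, Fintype.sum_prod_type_right]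
    refine Finset.sum_congr rfl fun v _ => ?_
    rw [tree_sum_idle]
    have hfin : ∀ o, (σ.tree u).sum φ (.fin (σ.pathWeight u v *
        σ.outputProb u (List.ofFn v) o) (List.ofFn v) o) = 0 := by
      intro o
      refine σ.tree_sum_eq_zero u hφ _ ?_
      simp only [Node.weight, outputProb, List.length_ofFn, if_pos (show m < n by omega), mul_zero]
    simp only [hfin, Finset.sum_const_zero, add_zero, tree_sum_pend]
    simp only [Fintype.sum_sigma, Fintype.sum_prod_type]
    refine Finset.sum_congr rfl fun i _ => Finset.sum_congr rfl fun x _ =>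
      Finset.sum_congr rfl fun a _ => ?_
    change _ = φ (.idle (σ.pathWeight u (Fin.snoc v ⟨i, x, a⟩)) (List.ofFn (Fin.snoc v ⟨i, x, a⟩)))
    rw [pathWeight_snoc]
    congr 2
    rw [List.ofFn_succ', List.concat_eq_append]
    simp

open Classical in
/-- The law of the complete transcript and the output of a party. -/
lemma Strategy.tree_sum_pow_out [Nonempty O] (θ : History X A → ℝ) (o : O) :
    ((σ.tree u).sum ^ (2 * n + 1))
        (fun g => if g.out = o then g.mass * θ g.hist else 0) (.idle 1 [])
      = ∑ t : Run X A, σ.choiceWeight u t * σ.output u (t.history n) o * θ (t.history n) := by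
  set φ : Node X A O → ℝ := fun g => if g.out = o then g.mass * θ g.hist else 0 with hφdef
  have hφ : ∀ g : Node X A O, g.weight = 0 → φ g = 0 := by
    intro g hg
    simp [hφdef, Node.mass, hg]
  rw [pow_succ, Module.End.mul_apply, tree_sum_pow_two_mul σ u n le_rfl _
    (σ.tree_sum_eq_zero u hφ)]
  symm
  -- Sequences of `n` actions that do not come from a run repeat a box and have mass zero.
  refine Finset.sum_of_injOn Run.actions Run.actions_injective.injOn (by simp) ?_ ?_
  · intro v _ hv
    have hnd : ¬ (List.ofFn v).keys.Nodup := fun hc => by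
      obtain ⟨t, ht⟩ := Run.exists_actions_eq ((nodup_keys_ofFn v).mp hc)
      exact hv ⟨t, by simp, ht⟩
    rw [tree_sum_idle]
    simp [hφdef, Node.mass_pend, Node.mass_fin, hnd]
  · intro t _
    rw [tree_sum_idle]
    have hc : ∀ c : Σ i, X i, φ (.pend (σ.pathWeight u t.actions *
        σ.chooseProb u (List.ofFn t.actions) c) (List.ofFn t.actions) c.1 c.2) = 0 := by
      intro c
      refine hφ _ ?_
      simp [Node.weight, chooseProb]
    simp only [hc, Finset.sum_const_zero, zero_add]
    rw [Finset.sum_eq_single o]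
    · simp only [hφdef, Node.out, if_true, Node.mass_fin, t.nodup_keys_actions, Node.hist,
        NNReal.coe_mul, coe_outputProb, List.length_ofFn, lt_irrefl, if_false,
        pathWeight_actions, Run.history_self]
    · intro o' _ ho'
      simp [hφdef, Node.out, ho']
    · simp

end Runs

end PhiRibbon

namespace PhiRibbon

/-! ### The joint law of the states of the two parties -/

section Joint

lemma prod_dlookup_append {n : ℕ} {β : Fin n → Type*} (F : ∀ i, Option (β i) → ℝ)
    {h : List (Σ i, β i)} {i : Fin n} (hi : i ∉ h.keys) (r : β i) :
    ∏ j, F j ((h ++ [(⟨i, r⟩ : Σ i, β i)]).dlookup j)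
      = F i (some r) * ∏ j ∈ Finset.univ.erase i, F j (h.dlookup j) := by
  rw [← Finset.mul_prod_erase _ _ (Finset.mem_univ i)]
  congr 1
  · rw [List.dlookup_append, List.dlookup_eq_none.mpr hi, List.dlookup_cons_eq, Option.none_or]
  · refine Finset.prod_congr rfl fun j hj => ?_
    rw [List.dlookup_append, List.dlookup_cons_ne _ _ (Finset.ne_of_mem_erase hj),
      List.dlookup_nil, Option.or_none]

lemma prod_dlookup {n : ℕ} {β : Fin n → Type*} (F : ∀ i, Option (β i) → ℝ)
    {h : List (Σ i, β i)} {i : Fin n} (hi : i ∉ h.keys) :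
    ∏ j, F j (h.dlookup j) = F i none * ∏ j ∈ Finset.univ.erase i, F j (h.dlookup j) := by
  rw [← Finset.mul_prod_erase _ _ (Finset.mem_univ i), List.dlookup_eq_none.mpr hi]

/-! ### Partial answers of a no-signaling box -/

section Box

variable {X Y A B : Type*} [Fintype A] [Fintype B] [Nonempty X] [Nonempty Y]

/-- The probability of the answers that a box has given so far. -/
noncomputable def NSBox.partialProb (p : NSBox X Y A B) :
    Option (X × A) → Option (Y × B) → ℝ
  | none, none => 1
  | some (x, a), none => margA (p.prob x (Classical.arbitrary Y)) a
  | none, some (y, b) => margB (p.prob (Classical.arbitrary X) y) b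
  | some (x, a), some (y, b) => p.prob x y (a, b)

lemma NSBox.partialProb_nonneg (p : NSBox X Y A B) (s : Option (X × A)) (t : Option (Y × B)) :
    0 ≤ p.partialProb s t := by
  match s, t with
  | none, none => exact zero_le_one
  | some (x, a), none => exact Finset.sum_nonneg fun b _ => p.prob_nonneg _ _ _
  | none, some (y, b) => exact Finset.sum_nonneg fun b _ => p.prob_nonneg _ _ _
  | some (x, a), some (y, b) => exact p.prob_nonneg _ _ _

/-- Normalization if the other end is unused; otherwise no-signaling, which makes the arbitrary
input in `partialProb` immaterial. -/
lemma NSBox.sum_partialProb_left (p : NSBox X Y A B) (x : X) (t : Option (Y × B)) :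
    ∑ a, p.partialProb (some (x, a)) t = p.partialProb none t := by
  match t with
  | none =>
    change ∑ a, ∑ b, p.prob x _ (a, b) = 1
    rw [← Fintype.sum_prod_type', p.prob_sum]
  | some (y, b) => exact p.noSignalingB _ _ _ _

lemma NSBox.sum_partialProb_right (p : NSBox X Y A B) (s : Option (X × A)) (y : Y) :
    ∑ b, p.partialProb s (some (y, b)) = p.partialProb s none := by
  match s with
  | none =>
    change ∑ b, ∑ a, p.prob _ y (a, b) = 1
    rw [← Fintype.sum_prod_type_right' (fun a b => p.prob _ y (a, b)), p.prob_sum]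
  | some (x, a) => exact p.noSignalingA _ _ _ _

end Box

variable {n : ℕ} {X Y A B : Fin n → Type*} [∀ i, Fintype (X i)] [∀ i, Fintype (Y i)]
  [∀ i, Fintype (A i)] [∀ i, Fintype (B i)] [∀ i, Nonempty (X i)] [∀ i, Nonempty (Y i)]
  {X' Y' A' B' : Type*} [Fintype A'] [Fintype B']

variable (p : ∀ i, NSBox (X i) (Y i) (A i) (B i))

/-- The probability of the answers that the boxes have given in a pair of transcripts. -/
noncomputable def answerProb (h : History X A) (k : History Y B) : ℝ :=
  ∏ i, (p i).partialProb (h.dlookup i) (k.dlookup i)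

lemma answerProb_nonneg (h : History X A) (k : History Y B) : 0 ≤ answerProb p h k :=
  Finset.prod_nonneg fun i _ => (p i).partialProb_nonneg _ _

lemma sum_answerProb_left {h : History X A} {i : Fin n} (hi : i ∉ h.keys) (x : X i)
    (k : History Y B) : ∑ a, answerProb p (h ++ [⟨i, x, a⟩]) k = answerProb p h k := by
  simp only [answerProb]
  rw [prod_dlookup (fun j s => (p j).partialProb s (k.dlookup j)) hi,
    ← (p i).sum_partialProb_left x, Finset.sum_mul]
  exact Finset.sum_congr rfl fun a _ =>
    prod_dlookup_append (fun j s => (p j).partialProb s (k.dlookup j)) hi _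

lemma sum_answerProb_right (h : History X A) {k : History Y B} {i : Fin n} (hi : i ∉ k.keys)
    (y : Y i) : ∑ b, answerProb p h (k ++ [⟨i, y, b⟩]) = answerProb p h k := by
  simp only [answerProb]
  rw [prod_dlookup (fun j s => (p j).partialProb (h.dlookup j) s) hi,
    ← (p i).sum_partialProb_right _ y, Finset.sum_mul]
  exact Finset.sum_congr rfl fun a _ =>
    prod_dlookup_append (fun j s => (p j).partialProb (h.dlookup j) s) hi _

lemma answerProb_append_append {h : History X A} {k : History Y B} {i : Fin n}
    (hi : i ∉ h.keys) (hi' : i ∉ k.keys) (x : X i) (y : Y i) (a : A i) (b : B i) :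
    answerProb p (h ++ [⟨i, x, a⟩]) (k ++ [⟨i, y, b⟩])
      = answerProb p h k * (p i).prob x y (a, b) := by
  simp only [answerProb]
  rw [prod_dlookup_append
      (fun j s => (p j).partialProb s ((k ++ [(⟨i, y, b⟩ : Σ i, Y i × B i)]).dlookup j)) hi,
    prod_dlookup (fun j s => (p j).partialProb s (k.dlookup j)) hi,
    List.dlookup_append, List.dlookup_eq_none.mpr hi', List.dlookup_cons_eq, Option.none_or,
    mul_comm]
  congr 1
  simp only [NSBox.partialProb, one_mul]
  refine Finset.prod_congr rfl fun j hj => ?_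
  rw [List.dlookup_append, List.dlookup_cons_ne _ _ (Finset.ne_of_mem_erase hj),
    List.dlookup_nil, Option.or_none]

/-- The probability of a pair of states of the two parties. -/
noncomputable def pairProb (g : Node X A A') (h : Node Y B B') : ℝ :=
  g.mass * h.mass * answerProb p g.hist h.hist

/-- The party in the state `g` waits for the answer of a box that neither party has used. -/
def Waiting (g : Node X A A') (h : Node Y B B') : Prop :=
  ∃ i, g.pending = some i ∧ i ∉ g.hist.keys ∧ i ∉ h.hist.keys

/-- Both parties wait for the answer of the same box, which neither party has used. -/
def Matched (g : Node X A A') (h : Node Y B B') : Prop :=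
  ∃ i, g.pending = some i ∧ h.pending = some i ∧ i ∉ g.hist.keys ∧ i ∉ h.hist.keys

lemma matched_comm {g : Node X A A'} {h : Node Y B B'} : Matched g h ↔ Matched h g := by
  constructor <;> rintro ⟨i, h1, h2, h3, h4⟩ <;> exact ⟨i, h2, h1, h4, h3⟩

variable (σ : Strategy X A X' A') (τ : Strategy Y B Y' B') (u : X') (v : Y')

/-- Bob's step adds exactly his pending box to the boxes he has used, so it ends Alice's wait for a
fresh box precisely when that box is hers. -/
lemma waiting_step (g : Node X A A') (h : Node Y B B') (e : (τ.tree v).Next h) :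
    Waiting g ((τ.tree v).step h e) ↔ Waiting g h ∧ ¬ Matched g h := by
  unfold Waiting Matched
  rw [τ.keys_hist_step v h e]
  constructor
  · rintro ⟨i, h1, h2, h3⟩
    simp only [List.mem_append, Option.mem_toList, not_or] at h3
    refine ⟨⟨i, h1, h2, h3.1⟩, ?_⟩
    rintro ⟨j, k1, k2, -⟩
    obtain rfl : i = j := Option.some.inj (h1.symm.trans k1)
    exact h3.2 k2
  · rintro ⟨⟨i, h1, h2, h3⟩, hm⟩
    refine ⟨i, h1, h2, ?_⟩
    simp only [List.mem_append, Option.mem_toList, not_or]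
    exact ⟨h3, fun h4 => hm ⟨i, h1, h4, h2, h3⟩⟩

lemma pairProb_nonneg (g : Node X A A') (h : Node Y B B') : 0 ≤ pairProb p g h :=
  mul_nonneg (mul_nonneg g.mass_nonneg h.mass_nonneg) (answerProb_nonneg p _ _)

/-- Choices are normalized by the strategy, and answers by no-signaling, whatever Bob has already
asked. -/
lemma sum_pairProb_left (g : Node X A A') (h : Node Y B B') :
    ∑ e, pairProb p ((σ.tree u).step g e) h = pairProb p g h := by
  have := σ.sum_mass_step u (θ := fun k => h.mass * answerProb p k h.hist)
    (fun k i x hi => by rw [← Finset.mul_sum, sum_answerProb_left p hi]) g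
  simp only [← mul_assoc] at this
  exact this

lemma sum_pairProb_right (g : Node X A A') (h : Node Y B B') :
    ∑ e, pairProb p g ((τ.tree v).step h e) = pairProb p g h := by
  have := τ.sum_mass_step v (θ := fun k => g.mass * answerProb p g.hist k)
    (fun k i x hi => by rw [← Finset.mul_sum, sum_answerProb_right p _ hi]) h
  simp only [← mul_assoc, mul_comm (Node.mass _) g.mass] at this
  exact this

/-- In states that are not matched, the next steps of the two parties are independent. -/
lemma pairProb_mul_of_not_matched {g : Node X A A'} {h : Node Y B B'} (hm : ¬ Matched g h)
    (e : (σ.tree u).Next g) (e' : (τ.tree v).Next h) :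
    pairProb p ((σ.tree u).step g e) ((τ.tree v).step h e') * pairProb p g h
      = pairProb p ((σ.tree u).step g e) h * pairProb p g ((τ.tree v).step h e') := by
  obtain ⟨c, hc⟩ := σ.exists_mass_step u g e
  obtain ⟨c', hc'⟩ := τ.exists_mass_step v h e'
  simp only [pairProb, hc, hc']
  rcases eq_or_ne g.mass 0 with hg | hg
  · simp [hg]
  rcases eq_or_ne h.mass 0 with hh | hh
  · simp [hh]
  have key : answerProb p ((σ.tree u).step g e).hist ((τ.tree v).step h e').hist
      * answerProb p g.hist h.hist
      = answerProb p ((σ.tree u).step g e).hist h.hist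
        * answerProb p g.hist ((τ.tree v).step h e').hist := by
    simp only [answerProb, ← Finset.prod_mul_distrib]
    refine Finset.prod_congr rfl fun i _ => ?_
    -- The identity holds box by box: away from matches, the entry of each box is unchanged on at
    -- least one side.
    by_cases hi : g.pending = some i
    · have hi' : h.pending ≠ some i := fun hi' => hm ⟨i, hi, hi',
        Node.notMem_keys_of_mass_ne_zero hg hi, Node.notMem_keys_of_mass_ne_zero hh hi'⟩
      rw [τ.dlookup_hist_step v e' hi']
    · rw [σ.dlookup_hist_step u e hi, mul_comm]
  linear_combination g.mass ^ 2 * h.mass ^ 2 * c * c' * key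

variable {D : Set ℝ} {Φ : ℝ → ℝ}

/-- In matched states, the next steps of the two parties satisfy the ribbon inequality of the
box. -/
lemma ribbon_inequality_of_matched {l : unitInterval × unitInterval}
    (hl : ∀ i, l ∈ (p i).ribbon D Φ) {g : Node X A A'} {h : Node Y B B'} (hm : Matched g h)
    (z : (σ.tree u).Next g → (τ.tree v).Next h → ℝ)
    (hz : ∀ e e', InCone D (pairProb p ((σ.tree u).step g e) ((τ.tree v).step h e')) (z e e')) :
    (l.1 : ℝ) * (∑ e, persp Φ (pairProb p ((σ.tree u).step g e) h) (∑ e', z e e')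
          - persp Φ (pairProb p g h) (∑ e, ∑ e', z e e'))
        + (l.2 : ℝ) * (∑ e', persp Φ (pairProb p g ((τ.tree v).step h e')) (∑ e, z e e')
          - persp Φ (pairProb p g h) (∑ e, ∑ e', z e e'))
        ≤ ∑ e, ∑ e', persp Φ (pairProb p ((σ.tree u).step g e) ((τ.tree v).step h e')) (z e e')
          - persp Φ (pairProb p g h) (∑ e, ∑ e', z e e') := by
  obtain ⟨i, hgi, hhi, hg, hh⟩ := hm
  match g, h with
  | .pend w k j x, .pend w' k' j' y =>
    obtain rfl : j = i := Option.some.inj hgi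
    obtain rfl : j' = j := Option.some.inj hhi
    -- Both inputs are already fixed in the pending states, so the ribbon at this single pair of
    -- inputs is what is needed.
    have hlxy : l ∈ ribbon D Φ ((p j').prob x y) :=
      Set.mem_iInter.mp (Set.mem_iInter.mp (hl j') x) y
    have hprob : ∀ a b, pairProb p ((σ.tree u).step (.pend w k j' x) ⟨a⟩)
        ((τ.tree v).step (.pend w' k' j' y) ⟨b⟩)
        = pairProb p (.pend w k j' x : Node X A A') (.pend w' k' j' y : Node Y B B')
          * (p j').prob x y (a, b) := by
      intro a b
      change (Node.idle w (k ++ [⟨j', x, a⟩]) : Node X A A').mass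
        * (Node.idle w' (k' ++ [⟨j', y, b⟩]) : Node Y B B').mass
        * answerProb p (k ++ [⟨j', x, a⟩]) (k' ++ [⟨j', y, b⟩]) = _
      rw [answerProb_append_append p (h := k) (k := k') hg hh, Node.mass_idle_append,
        Node.mass_idle_append, ← mul_assoc]
      rfl
    have sA : ∀ F : (σ.tree u).Next (.pend w k j' x) → ℝ, ∑ e, F e = ∑ a, F ⟨a⟩ :=
      fun F => sum_ulift F
    have sB : ∀ F : (τ.tree v).Next (.pend w' k' j' y) → ℝ, ∑ e, F e = ∑ b, F ⟨b⟩ :=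
      fun F => sum_ulift F
    have key := persp_ribbon hlxy (pairProb_nonneg p (.pend w k j' x : Node X A A')
      (.pend w' k' j' y : Node Y B B')) hprob ((p j').prob_nonneg x y) ((p j').prob_sum x y)
      (v := fun a b => z ⟨a⟩ ⟨b⟩) (fun a b => hz _ _)
    have wB : ∀ g : Node X A A', ∑ b, pairProb p g ((τ.tree v).step (.pend w' k' j' y) ⟨b⟩)
        = pairProb p g (.pend w' k' j' y) := fun g => by
      rw [← sum_pairProb_right p τ v g (.pend w' k' j' y), sB]
    have wA : ∀ h : Node Y B B', ∑ a, pairProb p ((σ.tree u).step (.pend w k j' x) ⟨a⟩) h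
        = pairProb p (.pend w k j' x) h := fun h => by
      rw [← sum_pairProb_left p σ u (.pend w k j' x) h, sA]
    simp only [wB, wA] at key
    simp only [sA, sB]
    exact key

open Classical in
/-- The outputs of the two decision trees have the law of the outputs of the wiring. -/
lemma outLaw_tree [Nonempty A'] [Nonempty B'] (a : A') (b : B') :
    (σ.tree u).outLaw (τ.tree v) (.idle 1 []) (.idle 1 []) (2 * n + 1) (pairProb p)
        Node.out Node.out a b
      = ∑ t : Run X A, ∑ s : Run Y B,
        jointLaw p σ τ u v t s * σ.output u (t.history n) a * τ.output v (s.history n) b := by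
  rw [Branching.outLaw, Branching.pairSum_apply]
  have inner : ∀ g : Node X A A', ((τ.tree v).sum ^ (2 * n + 1))
      (fun h : Node Y B B' => if g.out = a ∧ h.out = b then pairProb p g h else 0) (.idle 1 [])
      = if g.out = a then g.mass * ∑ s : Run Y B, τ.choiceWeight v s * τ.output v (s.history n) b
          * answerProb p g.hist (s.history n) else 0 := by
    intro g
    by_cases hg : g.out = a
    · rw [if_pos hg, ← τ.tree_sum_pow_out v (fun k => answerProb p g.hist k) b,
        ← smul_eq_mul g.mass, ← Pi.smul_apply, ← map_smul]
      refine congrFun (congrArg _ (funext fun h => ?_)) _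
      simp only [hg, true_and, Pi.smul_apply, smul_eq_mul, mul_ite, mul_zero, pairProb, mul_assoc]
    · have : (fun _ : Node Y B B' => (0 : ℝ)) = 0 := rfl
      simp [hg, this]
  simp only [inner]
  rw [σ.tree_sum_pow_out u (fun k => ∑ s : Run Y B, τ.choiceWeight v s *
    τ.output v (s.history n) b * answerProb p k (s.history n)) a]
  refine Finset.sum_congr rfl fun t _ => ?_
  rw [Finset.mul_sum]
  refine Finset.sum_congr rfl fun s _ => ?_
  have : answerProb p (t.history n) (s.history n)
      = ∏ i, (p i).prob (t.2.1 i) (s.2.1 i) (t.2.2 i, s.2.2 i) := by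
    simp only [answerProb, Run.dlookup_history]
    rfl
  rw [this, jointLaw]
  ring

end Joint

end PhiRibbon

/-! ### Conclusion: the ribbon of the generated box -/

open PhiRibbon

theorem mainTheorem1 {D : Set ℝ} {Φ : ℝ → ℝ} (hΦ : PhiRibbon.IsClassF D Φ) {n : ℕ}
    {X Y A B : Fin n → Type*} [∀ i, Fintype (X i)] [∀ i, Fintype (Y i)]
    [∀ i, Fintype (A i)] [∀ i, Fintype (B i)]
    {X' Y' A' B' : Type*} [Fintype A'] [Fintype B']
    (p : ∀ i, PhiRibbon.NSBox (X i) (Y i) (A i) (B i)) (q : PhiRibbon.NSBox X' Y' A' B')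
    (hq : PhiRibbon.IsWiring p q) :
    (⋂ i, (p i).ribbon D Φ) ⊆ q.ribbon D Φ := by
  intro l hl
  rw [NSBox.ribbon, Set.mem_iInter₂]
  intro u v
  obtain ⟨σ, τ, hq⟩ := hq
  rcases le_total ((l.1 : ℝ) + l.2) 1 with hsmall | hlarge
  · exact mem_ribbon_of_add_le_one hΦ.convexOn (q.prob_nonneg u v) (q.prob_sum u v) hsmall
  -- Some output pair has positive probability, so runs of both parties exist. They witness the
  -- nonemptiness of the output and input types that the default values in `Node.out` and
  -- `partialProb` require.
  obtain ⟨⟨a₀, b₀⟩, -, h₀⟩ := Finset.exists_ne_zero_of_sum_ne_zero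
    (ne_of_eq_of_ne (q.prob_sum u v) one_ne_zero)
  rw [hq] at h₀
  obtain ⟨t₀, -, ht₀⟩ := Finset.exists_ne_zero_of_sum_ne_zero h₀
  obtain ⟨s₀, -, -⟩ := Finset.exists_ne_zero_of_sum_ne_zero ht₀
  have : Nonempty A' := ⟨a₀⟩
  have : Nonempty B' := ⟨b₀⟩
  have : ∀ i, Nonempty (X i) := fun i => ⟨t₀.2.1 i⟩
  have : ∀ i, Nonempty (Y i) := fun i => ⟨s₀.2.1 i⟩
  -- The depth `2 * n + 1` counts a choice and an answer for each box, plus the final output.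
  have hlaw : q.prob u v = fun z => (σ.tree u).outLaw (τ.tree v) (.idle 1 []) (.idle 1 [])
      (2 * n + 1) (pairProb p) Node.out Node.out z.1 z.2 := by
    funext ⟨a, b⟩
    rw [hq, outLaw_tree]
  rw [hlaw]
  refine (σ.tree u).mem_ribbon_outLaw (τ.tree v) _ _ _ _ _ _ hΦ Matched Waiting
    (fun g h => Waiting h g) hlarge (pairProb_nonneg p) ?_ (sum_pairProb_left p σ u)
    (sum_pairProb_right p τ v) (fun g h hm => pairProb_mul_of_not_matched p σ τ u v hm)
    (fun g h hm => ribbon_inequality_of_matched p σ τ u v (fun i => Set.mem_iInter.mp hl i) hm)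
    ?_ ?_ (fun g h e => waiting_step τ v g h e) ?_
  · simp [pairProb, Node.mass, Node.hist, Node.pending, Node.weight, answerProb,
      NSBox.partialProb]
  · rintro g h ⟨i, h1, -, h3, h4⟩
    exact ⟨i, h1, h3, h4⟩
  · rintro g h ⟨i, -, h2, h3, h4⟩
    exact ⟨i, h2, h4, h3⟩
  · intro g h e
    rw [waiting_step σ u h g e, matched_comm]
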